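/- Let $S$ be a Polish space with its Borel $\sigma$-algebra, let $(P_t)_{t\ge 0}$ be a semigroup of Markov kernels on $S$ with stationary probability distribution $\pi$, and suppose that it acts as a strongly continuous contraction semigroup on the real Hilbert space $L^2(\pi)$, with scalar product $(u,v)=\int uv\,d\pi$. Let $X=(X_t)_{t\ge0}$ be a (jointly measurable) Markov process with transition semigroup $(P_t)$ and $X_0\sim\pi$. Suppose that $(P_t)$ is $L^2$-exponentially ergodic: there are constants $C,\lambda_1>0$ with $\|P_tu\|\le C\|u\|e^{-\lambda_1t}$ for all $t\ge0$ and all $u\in L^2_0(\pi)=\{u\in L^2(\pi):\int u\,d\pi=0\}$. Let $f\in L^2_0(\pi)$. (1) The limit $$\sigma^2(X,f)=\lim_{t\to\infty}\mathbb E_\pi\Big[\Big(\frac1{\sqrt t}\int_0^tf(X_s)\,ds\Big)^2\Big]$$ exists and is finite, the integral $Gf=\int_0^\infty P_tf\,dt$ converges absolutely in $L^2(\pi)$, and $\sigma^2(X,f)=2(Gf,f)$. (2) Let $(L,\mathscr D(L))$ be the infinitesimal generator of $(P_t)$ in $L^2(\pi)$ and put $\mathscr E(u,v)=(-Lu,v)$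 for $u,v\in\mathscr D(L)$. Suppose in addition that the sector condition holds: there is $K>0$ with $|\mathscr E(u,v)|\le K\,\mathscr E(u,u)^{1/2}\mathscr E(v,v)^{1/2}$ for all $u,v\in\mathscr D(L)$. Let $(\mathscr E,\mathscr F)$ be the associated semi-Dirichlet form, where $\mathscr F\subset L^2(\pi)$ is the completion of $\mathscr D(L)$ for the norm $(\mathscr E(u,u)+(u,u))^{1/2}$ and $\mathscr E$ is extended to $\mathscr F$ by continuity. Then $$\frac{2}{\sigma^2(X,f)}=\inf_{u\in\mathscr F,\ (u,f)=1}\ \ \sup_{v\in\mathscr F,\ (v,f)=0}\mathscr E(u+v,u-v).$$ (3) If $X$ is reversible, i.e. $\pi(dx)P_t(x,dy)=\pi(dy)P_t(y,dx)$ for all $t\ge0$ (in which case the sector condition holds automatically), then $$\frac{2}{\sigma^2(X,f)}=\inf_{u\in\mathscr F,\ (u,f)=1}\mathscr E(u,u).$$ In (2) and (3) the conventions $2/0=+\infty$ and $\inf\emptyset=+\infty$ are used; they matter only for $f=0$. -/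

import Mathlib

open MeasureTheory ProbabilityTheory Filter Topology
open scoped NNReal ENNReal

namespace AsymptoticVariance

section Semigroup

variable {S : Type*} [MeasurableSpace S]

/-- A family of kernels is a transition semigroup: `P 0` is the identity kernel and the
Chapman-Kolmogorov equations hold. -/
structure IsTransitionSemigroup (P : ℝ≥0 → Kernel S S) : Prop where
  zero : P 0 = Kernel.id
  add : ∀ s t, P (s + t) = P t ∘ₖ P s

/-- A Markov kernel with invariant measure `π` maps square integrable functions to square
integrable functions. -/
theorem memLp_kernel_integral {π : Measure S} (κ : Kernel S S) [IsMarkovKernel κ]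
    (hκ : κ.Invariant π) (u : Lp ℝ 2 π) :
    MemLp (fun x => ∫ y, u y ∂(κ x)) 2 π := by
  have hu : StronglyMeasurable (u : S → ℝ) := Lp.stronglyMeasurable u
  have hm : StronglyMeasurable (fun x => ∫ y, u y ∂(κ x)) :=
    StronglyMeasurable.integral_kernel (κ := κ) hu
  refine ⟨hm.aestronglyMeasurable, ?_⟩
  have key : ∀ x, ‖∫ y, u y ∂(κ x)‖ₑ ^ (2 : ℝ) ≤ ∫⁻ y, ‖u y‖ₑ ^ (2 : ℝ) ∂(κ x) := by
    intro x
    have h1 : ‖∫ y, u y ∂(κ x)‖ₑ ≤ eLpNorm u 2 (κ x) := by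
      calc ‖∫ y, u y ∂(κ x)‖ₑ ≤ ∫⁻ y, ‖u y‖ₑ ∂(κ x) := enorm_integral_le_lintegral_enorm _
        _ = eLpNorm u 1 (κ x) := eLpNorm_one_eq_lintegral_enorm.symm
        _ ≤ eLpNorm u 2 (κ x) :=
          eLpNorm_le_eLpNorm_of_exponent_le (by norm_num) hu.aestronglyMeasurable
    calc ‖∫ y, u y ∂(κ x)‖ₑ ^ (2 : ℝ) ≤ (eLpNorm u 2 (κ x)) ^ (2 : ℝ) :=
          ENNReal.rpow_le_rpow h1 (by norm_num)
      _ = _ := by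
          rw [eLpNorm_eq_lintegral_rpow_enorm_toReal (by norm_num) (by norm_num)]
          rw [← ENNReal.rpow_mul]
          simp
  have hfin := Lp.eLpNorm_lt_top u
  rw [eLpNorm_lt_top_iff_lintegral_rpow_enorm_lt_top (by norm_num) (by norm_num)] at hfin ⊢
  simp only [ENNReal.toReal_ofNat] at hfin ⊢
  refine lt_of_le_of_lt (lintegral_mono key) ?_
  have hmeas : Measurable (fun y => ‖u y‖ₑ ^ (2 : ℝ)) := hu.measurable.enorm.pow_const _
  rw [← Measure.lintegral_bind κ.measurable.aemeasurable hmeas.aemeasurable, hκ.def]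
  exact hfin

/-- The action `(P_t u)(x) = ∫ u(y) P_t(x, dy)` of a transition semigroup with stationary
distribution `π` on the real Hilbert space `L²(π)`. -/
noncomputable def semigroupL2 {π : Measure S} (P : ℝ≥0 → Kernel S S)
    [∀ t, IsMarkovKernel (P t)] (hπ : ∀ t, (P t).Invariant π) (t : ℝ≥0) (u : Lp ℝ 2 π) :
    Lp ℝ 2 π :=
  (memLp_kernel_integral (P t) (hπ t) u).toLp _

variable {π : Measure S}

/-- Strong continuity at time zero. -/
def StronglyContinuous (T : ℝ≥0 → Lp ℝ 2 π → Lp ℝ 2 π) : Prop :=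
  ∀ u, Tendsto (fun t => T t u) (𝓝[>] 0) (𝓝 u)

/-- `L²`-exponential ergodicity: exponential decay on the mean-zero functions. -/
def ExponentiallyErgodic (T : ℝ≥0 → Lp ℝ 2 π → Lp ℝ 2 π) : Prop :=
  ∃ C lam : ℝ, 0 < C ∧ 0 < lam ∧ ∀ u : Lp ℝ 2 π, ∫ x, u x ∂π = 0 →
    ∀ t : ℝ≥0, ‖T t u‖ ≤ C * ‖u‖ * Real.exp (-lam * t)

/-- The domain of the infinitesimal generator: all `u` for which `(P_t u - u) / t` converges
in `L²(π)` as `t ↓ 0`. -/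
def generatorDomain (T : ℝ≥0 → Lp ℝ 2 π → Lp ℝ 2 π) : Set (Lp ℝ 2 π) :=
  {u | ∃ w, Tendsto (fun t : ℝ≥0 => (t : ℝ)⁻¹ • (T t u - u)) (𝓝[>] 0) (𝓝 w)}

/-- The infinitesimal generator `L u = lim_{t ↓ 0} (P_t u - u) / t`; it is meaningful on
`generatorDomain T`. -/
noncomputable def generator (T : ℝ≥0 → Lp ℝ 2 π → Lp ℝ 2 π) (u : Lp ℝ 2 π) : Lp ℝ 2 π :=
  limUnder (𝓝[>] (0 : ℝ≥0)) (fun t : ℝ≥0 => (t : ℝ)⁻¹ • (T t u - u))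

/-- The bilinear form `(-L u, v)`; it is meaningful for `u` and `v` in the domain of `L`. -/
noncomputable def preForm (T : ℝ≥0 → Lp ℝ 2 π → Lp ℝ 2 π) (u v : Lp ℝ 2 π) : ℝ :=
  inner ℝ (-generator T u) v

/-- The sector condition for `(L, D(L))`. -/
def SectorCondition (T : ℝ≥0 → Lp ℝ 2 π → Lp ℝ 2 π) : Prop :=
  ∃ K : ℝ, 0 < K ∧ ∀ u ∈ generatorDomain T, ∀ v ∈ generatorDomain T,
    |preForm T u v| ≤ K * √(preForm T u u) * √(preForm T v v)

/-- A sequence in `D(L)` that converges to `u` in `L²(π)` and is Cauchy for the energy; that is,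
a sequence that is Cauchy for the norm `(E(u, u) + (u, u))^{1/2}` and represents `u`. -/
structure IsApproximating (T : ℝ≥0 → Lp ℝ 2 π → Lp ℝ 2 π) (us : ℕ → Lp ℝ 2 π)
    (u : Lp ℝ 2 π) : Prop where
  mem : ∀ n, us n ∈ generatorDomain T
  tendsto : Tendsto us atTop (𝓝 u)
  cauchy : Tendsto (fun p : ℕ × ℕ => preForm T (us p.1 - us p.2) (us p.1 - us p.2))
    atTop (𝓝 0)

/-- The domain of the semi-Dirichlet form: the completion of `D(L)` for the norm
`(E(u, u) + (u, u))^{1/2}`, realized inside `L²(π)`. -/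
def formDomain (T : ℝ≥0 → Lp ℝ 2 π → Lp ℝ 2 π) : Set (Lp ℝ 2 π) :=
  {u | ∃ us, IsApproximating T us u}

open Classical in
/-- The semi-Dirichlet form: the extension of `preForm` to `formDomain` by continuity, that is,
the common limit of `E(u_n, v_n)` along all approximating sequences. -/
noncomputable def form (T : ℝ≥0 → Lp ℝ 2 π → Lp ℝ 2 π) (u v : Lp ℝ 2 π) : ℝ :=
  if h : ∃ c : ℝ, ∀ us vs, IsApproximating T us u → IsApproximating T vs v →
      Tendsto (fun n => preForm T (us n) (vs n)) atTop (𝓝 c)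
  then h.choose else 0

/-- The sets `{u ∈ F : (u, f) = δ}`. -/
def constraintSet (T : ℝ≥0 → Lp ℝ 2 π → Lp ℝ 2 π) (f : Lp ℝ 2 π) (δ : ℝ) : Set (Lp ℝ 2 π) :=
  {u | u ∈ formDomain T ∧ inner ℝ u f = δ}

/-- The potential `G f = ∫₀^∞ P_t f dt`, a Bochner integral in `L²(π)`. -/
noncomputable def potential (T : ℝ≥0 → Lp ℝ 2 π → Lp ℝ 2 π) (f : Lp ℝ 2 π) : Lp ℝ 2 π :=
  ∫ t in Set.Ioi (0 : ℝ), T t.toNNReal f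

end Semigroup

section Paths

variable {S Ω : Type*} [MeasurableSpace S] [MeasurableSpace Ω]

/-- `X` is, under `Q`, a (jointly measurable) Markov process with transition semigroup `P` and
initial distribution `π`; the Markov property refers to the filtration generated by `X`. -/
structure IsMarkovProcess (P : ℝ≥0 → Kernel S S) (π : Measure S) (Q : Measure Ω)
    (X : ℝ≥0 → Ω → S) : Prop where
  measurable : Measurable (fun p : ℝ≥0 × Ω => X p.1 p.2)
  initial : Q.map (X 0) = π
  markov : ∀ (s t : ℝ≥0) (A : Set S), MeasurableSet A →
    Q[(X (s + t) ⁻¹' A).indicator (fun _ => (1 : ℝ)) |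
        ⨆ r : Set.Iic s, MeasurableSpace.comap (X r) inferInstance]
      =ᵐ[Q] fun ω => (P t (X s ω)).real A

/-- `𝔼[(t^{-1/2} ∫₀ᵗ f(X_s) ds)²]`, with values in `[0, ∞]`. -/
noncomputable def scaledSecondMoment (Q : Measure Ω) (X : ℝ≥0 → Ω → S) (f : S → ℝ) (t : ℝ) :
    ℝ≥0∞ :=
  ∫⁻ ω, ENNReal.ofReal ((1 / √t * ∫ s in (0 : ℝ)..t, f (X s.toNNReal ω)) ^ 2) ∂Q

/-- The asymptotic variance `σ²(X, f)`, with values in `[0, ∞]`. -/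
noncomputable def asymptoticVariance (Q : Measure Ω) (X : ℝ≥0 → Ω → S) (f : S → ℝ) : ℝ≥0∞ :=
  limsup (scaledSecondMoment Q X f) atTop

end Paths

end AsymptoticVariance

/-!
The asymptotic variance of a stationary Markov process and its variational formulas.

*The limit.* The pair `(X_s, X_{s+t})` has law `π(dx) P_t(x, dy)`, so the autocovariance of `f(X)`
is `ρ(r) = (f, P_r f)`, which is integrable by exponential ergodicity. By Fubini the normalized
second moment at time `t` is twice the mean over `[0, t]` of the primitive of `ρ`, and these means
converge to `2 ∫₀^∞ ρ = 2 (G f, f)` (`tendsto_scaledSecondMoment`).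

*The form.* On the domain of the generator `L` the energy `(-L u, v)` is nonnegative on the
diagonal, and the sector condition makes it closable, so it extends to a bilinear form computed
along arbitrary approximating sequences (`IsContractionSemigroup.tendsto_form`).

*The saddle point.* Put `a = G f` and let `b` be the adjoint of the potential operator applied to
`f`. Then `E(a, v) = (f, v)` since `-L a = f`, and `E(v, b) = (v, f)`. That `b` lies in the form
domain is the delicate point: the resolvent approximations `b_α = α (α - L)⁻¹ b` satisfy
`E(b_α, b_α) = (b_α, f) - α ‖b_α - b‖²`, so they converge to `b` with bounded energy, and a
convexity argument (`IsContractionSemigroup.exists_isApproximating`) turns this into an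
energy-Cauchy sequence. With `c = (G f, f)`, for `z` and `w` orthogonal to `f` one finds
`E(a / c + z, b / c + w) = 1 / c + E(z, w)` (`IsErgodicSemigroup.form_saddle`). Choosing `w = -z`
bounds the supremum at `u = (a + b) / 2c` by `1 / c`; choosing `w = z` shows that no other `u` does
better. In the reversible case the form is symmetric, so `b` may be replaced by `a`, and `a / c` is
a minimizer.
-/

namespace AsymptoticVariance

/-! ### The action of a stationary Markov kernel on square integrable functions -/

section Kernel

variable {S : Type*} [MeasurableSpace S] {π : Measure S}

theorem integral_comp_measurePreserving {α β : Type*} [MeasurableSpace α] [MeasurableSpace β]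
    {μ : Measure α} {ν : Measure β} {φ : α → β} (hφ : MeasurePreserving φ μ ν) {g : β → ℝ}
    (hg : AEStronglyMeasurable g ν) : ∫ a, g (φ a) ∂μ = ∫ b, g b ∂ν := by
  obtain ⟨hm, rfl⟩ := hφ
  exact (integral_map hm.aemeasurable hg).symm

theorem inner_eq_integral_mul (u v : Lp ℝ 2 π) : inner ℝ u v = ∫ x, u x * v x ∂π := by
  rw [L2.inner_def]
  refine integral_congr_ae (ae_of_all _ fun x => ?_)
  simp [mul_comm]

theorem norm_sq_eq_integral (u : Lp ℝ 2 π) : ‖u‖ ^ 2 = ∫ x, u x ^ 2 ∂π := by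
  rw [← real_inner_self_eq_norm_sq, inner_eq_integral_mul]
  simp only [sq]

theorem ae_kernel_of_ae {κ : Kernel S S} [IsMarkovKernel κ] (hκ : κ.Invariant π)
    {p : S → Prop} (hp : ∀ᵐ x ∂π, p x) : ∀ᵐ x ∂π, ∀ᵐ y ∂(κ x), p y :=
  Measure.ae_ae_of_ae_bind κ.aemeasurable (by rwa [hκ.def])

theorem semigroupL2_coeFn (P : ℝ≥0 → Kernel S S) [∀ t, IsMarkovKernel (P t)]
    (hπ : ∀ t, (P t).Invariant π) (t : ℝ≥0) (u : Lp ℝ 2 π) :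
    semigroupL2 P hπ t u =ᵐ[π] fun x => ∫ y, u y ∂(P t x) :=
  (memLp_kernel_integral (P t) (hπ t) u).coeFn_toLp

theorem semigroupL2_zero (P : ℝ≥0 → Kernel S S) [∀ t, IsMarkovKernel (P t)]
    (hπ : ∀ t, (P t).Invariant π) (hP : IsTransitionSemigroup P) (u : Lp ℝ 2 π) :
    semigroupL2 P hπ 0 u = u := by
  refine Lp.ext ?_
  filter_upwards [semigroupL2_coeFn P hπ 0 u] with x hx
  rw [hx, hP.zero, Kernel.id_apply,
    integral_dirac' _ _ (Lp.stronglyMeasurable u)]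

variable [IsProbabilityMeasure π]

theorem snd_compProd_of_invariant {κ : Kernel S S} [IsMarkovKernel κ] (hκ : κ.Invariant π) :
    (π ⊗ₘ κ).snd = π := by
  rw [Measure.snd_compProd]; exact hκ

theorem measurePreserving_fst_compProd (κ : Kernel S S) [IsMarkovKernel κ] :
    MeasurePreserving Prod.fst (π ⊗ₘ κ) π :=
  ⟨measurable_fst, Measure.fst_compProd π κ⟩

theorem measurePreserving_snd_compProd {κ : Kernel S S} [IsMarkovKernel κ]
    (hκ : κ.Invariant π) : MeasurePreserving Prod.snd (π ⊗ₘ κ) π :=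
  ⟨measurable_snd, snd_compProd_of_invariant hκ⟩

theorem integrable_fst_mul_snd {κ : Kernel S S} [IsMarkovKernel κ] (hκ : κ.Invariant π)
    (v u : Lp ℝ 2 π) : Integrable (fun p : S × S => v p.1 * u p.2) (π ⊗ₘ κ) :=
  ((Lp.memLp v).comp_measurePreserving (measurePreserving_fst_compProd κ)).integrable_mul
    ((Lp.memLp u).comp_measurePreserving (measurePreserving_snd_compProd hκ))

/-- The pairing of `v` with `κ u` is an integral against the law `π(dx) κ(x, dy)` of one step of
the stationary chain. -/
theorem inner_toLp_kernel_integral {κ : Kernel S S} [IsMarkovKernel κ] (hκ : κ.Invariant π)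
    (v u : Lp ℝ 2 π) :
    inner ℝ v ((memLp_kernel_integral κ hκ u).toLp _) = ∫ p, v p.1 * u p.2 ∂(π ⊗ₘ κ) := by
  rw [inner_eq_integral_mul, Measure.integral_compProd (integrable_fst_mul_snd hκ v u)]
  refine integral_congr_ae ?_
  filter_upwards [(memLp_kernel_integral κ hκ u).coeFn_toLp] with x hx
  rw [hx, integral_const_mul]

variable (P : ℝ≥0 → Kernel S S) [∀ t, IsMarkovKernel (P t)] (hπ : ∀ t, (P t).Invariant π)

theorem inner_semigroupL2 (t : ℝ≥0) (v u : Lp ℝ 2 π) :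
    inner ℝ v (semigroupL2 P hπ t u) = ∫ p, v p.1 * u p.2 ∂(π ⊗ₘ P t) :=
  inner_toLp_kernel_integral (hπ t) v u

theorem semigroupL2_add (t : ℝ≥0) (u w : Lp ℝ 2 π) :
    semigroupL2 P hπ t (u + w) = semigroupL2 P hπ t u + semigroupL2 P hπ t w := by
  refine ext_inner_left ℝ fun v => ?_
  rw [inner_add_right]
  simp only [inner_semigroupL2]
  rw [← integral_add (integrable_fst_mul_snd (hπ t) v u) (integrable_fst_mul_snd (hπ t) v w)]
  refine integral_congr_ae ?_
  filter_upwards [(measurePreserving_snd_compProd (hπ t)).quasiMeasurePreserving.ae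
    (Lp.coeFn_add u w)] with p hp
  rw [hp, Pi.add_apply, mul_add]

theorem semigroupL2_smul (t : ℝ≥0) (c : ℝ) (u : Lp ℝ 2 π) :
    semigroupL2 P hπ t (c • u) = c • semigroupL2 P hπ t u := by
  refine ext_inner_left ℝ fun v => ?_
  rw [inner_smul_right]
  simp only [inner_semigroupL2]
  rw [← integral_const_mul]
  refine integral_congr_ae ?_
  filter_upwards [(measurePreserving_snd_compProd (hπ t)).quasiMeasurePreserving.ae
    (Lp.coeFn_smul c u)] with p hp
  rw [hp, Pi.smul_apply, smul_eq_mul]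
  ring

theorem norm_semigroupL2_le (t : ℝ≥0) (u : Lp ℝ 2 π) : ‖semigroupL2 P hπ t u‖ ≤ ‖u‖ := by
  set v := semigroupL2 P hπ t u with hv
  have h1 := measurePreserving_fst_compProd (π := π) (P t)
  have h2 := measurePreserving_snd_compProd (hπ t)
  have i1 : Integrable (fun p : S × S => v p.1 ^ 2) (π ⊗ₘ P t) :=
    ((Lp.memLp v).comp_measurePreserving h1).integrable_sq
  have i2 : Integrable (fun p : S × S => u p.2 ^ 2) (π ⊗ₘ P t) :=
    ((Lp.memLp u).comp_measurePreserving h2).integrable_sq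
  have e1 : ∫ p, v p.1 ^ 2 ∂(π ⊗ₘ P t) = ‖v‖ ^ 2 := by
    rw [norm_sq_eq_integral]
    exact integral_comp_measurePreserving h1 (Lp.memLp v).integrable_sq.aestronglyMeasurable
  have e2 : ∫ p, u p.2 ^ 2 ∂(π ⊗ₘ P t) = ‖u‖ ^ 2 := by
    rw [norm_sq_eq_integral]
    exact integral_comp_measurePreserving h2 (Lp.memLp u).integrable_sq.aestronglyMeasurable
  have key : 2 * ‖v‖ ^ 2 ≤ ‖v‖ ^ 2 + ‖u‖ ^ 2 := by
    calc 2 * ‖v‖ ^ 2 = ∫ p, 2 * (v p.1 * u p.2) ∂(π ⊗ₘ P t) := by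
          rw [integral_const_mul, ← inner_semigroupL2 P hπ, ← hv, real_inner_self_eq_norm_sq]
      _ ≤ ∫ p, (v p.1 ^ 2 + u p.2 ^ 2) ∂(π ⊗ₘ P t) := by
          refine integral_mono ((integrable_fst_mul_snd (hπ t) v u).const_mul 2) (i1.add i2)
            fun p => ?_
          have := two_mul_le_add_sq (v p.1) (u p.2)
          linarith
      _ = ‖v‖ ^ 2 + ‖u‖ ^ 2 := by rw [integral_add i1 i2, e1, e2]
  exact abs_le_of_sq_le_sq' (by linarith) (norm_nonneg _) |>.2

theorem semigroupL2_add_time (hP : IsTransitionSemigroup P) (s t : ℝ≥0) (u : Lp ℝ 2 π) :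
    semigroupL2 P hπ (s + t) u = semigroupL2 P hπ s (semigroupL2 P hπ t u) := by
  have hu : Integrable (fun p : S × S => u p.2) (π ⊗ₘ P (s + t)) :=
    (((Lp.memLp u).comp_measurePreserving
      (measurePreserving_snd_compProd (hπ (s + t)))).integrable one_le_two)
  have hint := (Measure.integrable_compProd_iff hu.aestronglyMeasurable).1 hu |>.1
  refine Lp.ext ?_
  filter_upwards [semigroupL2_coeFn P hπ (s + t) u,
    semigroupL2_coeFn P hπ s (semigroupL2 P hπ t u), hint,
    ae_kernel_of_ae (hπ s) (semigroupL2_coeFn P hπ t u)] with x h1 h2 h3 h4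
  rw [h1, h2, integral_congr_ae h4]
  rw [hP.add s t] at h3 ⊢
  rw [Kernel.integral_comp h3]

/-- The constant function one as an element of `L²(π)`. -/
noncomputable def oneL2 (π : Measure S) [IsProbabilityMeasure π] : Lp ℝ 2 π :=
  (memLp_const (1 : ℝ)).toLp _

theorem oneL2_coeFn : oneL2 π =ᵐ[π] fun _ => (1 : ℝ) := MemLp.coeFn_toLp _

theorem inner_oneL2 (u : Lp ℝ 2 π) : inner ℝ (oneL2 π) u = ∫ x, u x ∂π := by
  rw [inner_eq_integral_mul]
  refine integral_congr_ae ?_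
  filter_upwards [oneL2_coeFn (π := π)] with x hx
  rw [hx, one_mul]

theorem inner_oneL2_self : inner ℝ (oneL2 π) (oneL2 π) = 1 := by
  rw [inner_oneL2, integral_congr_ae oneL2_coeFn]
  simp

theorem semigroupL2_oneL2 (t : ℝ≥0) : semigroupL2 P hπ t (oneL2 π) = oneL2 π := by
  refine Lp.ext ?_
  filter_upwards [semigroupL2_coeFn P hπ t (oneL2 π), oneL2_coeFn (π := π),
    ae_kernel_of_ae (hπ t) (oneL2_coeFn (π := π))] with x h1 h2 h3
  rw [h1, h2, integral_congr_ae h3]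
  simp

theorem inner_oneL2_semigroupL2 (t : ℝ≥0) (u : Lp ℝ 2 π) :
    inner ℝ (oneL2 π) (semigroupL2 P hπ t u) = inner ℝ (oneL2 π) u := by
  have h1 := measurePreserving_fst_compProd (π := π) (P t)
  have h2 := measurePreserving_snd_compProd (hπ t)
  rw [inner_semigroupL2, inner_oneL2]
  rw [← integral_comp_measurePreserving h2 (Lp.aestronglyMeasurable u)]
  refine integral_congr_ae ?_
  filter_upwards [h1.quasiMeasurePreserving.ae (oneL2_coeFn (π := π))] with p hp
  rw [hp, one_mul]

theorem compProd_map_swap_of_isReversible {κ : Kernel S S} [IsMarkovKernel κ]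
    (h : κ.IsReversible π) : (π ⊗ₘ κ).map Prod.swap = π ⊗ₘ κ := by
  have : IsProbabilityMeasure ((π ⊗ₘ κ).map Prod.swap) :=
    Measure.isProbabilityMeasure_map measurable_swap.aemeasurable
  refine Measure.ext_prod fun {s t} hs ht => ?_
  rw [Measure.map_apply measurable_swap (hs.prod ht), Set.preimage_swap_prod,
    Measure.compProd_apply_prod ht hs, Measure.compProd_apply_prod hs ht, h hs ht]

/-- A reversible transition semigroup acts by self-adjoint operators. -/
theorem inner_semigroupL2_comm (hrev : ∀ t, (P t).IsReversible π) (t : ℝ≥0) (u v : Lp ℝ 2 π) :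
    inner ℝ v (semigroupL2 P hπ t u) = inner ℝ (semigroupL2 P hπ t v) u := by
  have hi := integrable_fst_mul_snd (hπ t) v u
  rw [real_inner_comm u, inner_semigroupL2, inner_semigroupL2]
  conv_lhs => rw [← compProd_map_swap_of_isReversible (hrev t)]
  rw [integral_map measurable_swap.aemeasurable]
  · simp only [Prod.fst_swap, Prod.snd_swap, mul_comm]
  · rw [compProd_map_swap_of_isReversible (hrev t)]
    exact hi.aestronglyMeasurable

end Kernel

/-! ### Contraction semigroups and their generators -/

section ContractionSemigroup

variable {S : Type*} [MeasurableSpace S] {π : Measure S} {T : ℝ≥0 → Lp ℝ 2 π → Lp ℝ 2 π}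

/-- A strongly continuous semigroup of linear contractions on `L²(π)`. -/
structure IsContractionSemigroup (T : ℝ≥0 → Lp ℝ 2 π → Lp ℝ 2 π) : Prop where
  map_add : ∀ t u v, T t (u + v) = T t u + T t v
  map_smul : ∀ t (c : ℝ) u, T t (c • u) = c • T t u
  norm_le : ∀ t u, ‖T t u‖ ≤ ‖u‖
  zero : ∀ u, T 0 u = u
  add : ∀ s t u, T (s + t) u = T s (T t u)
  stronglyContinuous : StronglyContinuous T

/-- The element `u` lies in the domain of the generator, and the generator maps it to `w`. -/
def HasGenerator (T : ℝ≥0 → Lp ℝ 2 π → Lp ℝ 2 π) (u w : Lp ℝ 2 π) : Prop :=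
  Tendsto (fun t : ℝ≥0 => (t : ℝ)⁻¹ • (T t u - u)) (𝓝[>] 0) (𝓝 w)

theorem HasGenerator.mem {u w : Lp ℝ 2 π} (h : HasGenerator T u w) : u ∈ generatorDomain T :=
  ⟨w, h⟩

theorem HasGenerator.generator_eq {u w : Lp ℝ 2 π} (h : HasGenerator T u w) :
    generator T u = w :=
  h.limUnder_eq

theorem hasGenerator_of_mem {u : Lp ℝ 2 π} (h : u ∈ generatorDomain T) :
    HasGenerator T u (generator T u) := by
  obtain ⟨w, hw⟩ := h
  have hw : HasGenerator T u w := hw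
  rwa [hw.generator_eq]

namespace IsContractionSemigroup

variable (hT : IsContractionSemigroup T)
include hT

/-- The operators of a contraction semigroup as continuous linear maps. -/
noncomputable def clm (t : ℝ≥0) : Lp ℝ 2 π →L[ℝ] Lp ℝ 2 π :=
  LinearMap.mkContinuous ⟨⟨T t, hT.map_add t⟩, hT.map_smul t⟩ 1
    fun u => by simpa using hT.norm_le t u

theorem map_sub (t : ℝ≥0) (u v : Lp ℝ 2 π) : T t (u - v) = T t u - T t v :=
  _root_.map_sub (hT.clm t) u v

theorem hasGenerator_add {u v w z : Lp ℝ 2 π} (hu : HasGenerator T u w)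
    (hv : HasGenerator T v z) : HasGenerator T (u + v) (w + z) := by
  refine (Tendsto.add hu hv).congr fun t => ?_
  rw [hT.map_add, ← smul_add]
  congr 1
  abel

theorem hasGenerator_smul {u w : Lp ℝ 2 π} (c : ℝ) (hu : HasGenerator T u w) :
    HasGenerator T (c • u) (c • w) := by
  refine (Tendsto.const_smul hu c).congr fun t => ?_
  rw [hT.map_smul, smul_comm, smul_sub]

theorem inner_generator_nonpos {u w : Lp ℝ 2 π} (h : HasGenerator T u w) :
    inner ℝ w u ≤ 0 := by
  refine le_of_tendsto (h.inner tendsto_const_nhds) (Eventually.of_forall fun t => ?_)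
  rw [real_inner_smul_left, inner_sub_left, real_inner_self_eq_norm_sq]
  refine mul_nonpos_of_nonneg_of_nonpos (by positivity) ?_
  have h1 := real_inner_le_norm (T t u) u
  have h2 := mul_le_mul_of_nonneg_right (hT.norm_le t u) (norm_nonneg u)
  nlinarith

theorem tendsto_nhds_zero (u : Lp ℝ 2 π) : Tendsto (fun t => T t u) (𝓝 0) (𝓝 u) := by
  have h : ContinuousWithinAt (fun t => T t u) (Set.Ioi 0) 0 := by
    have := hT.stronglyContinuous u
    rwa [ContinuousWithinAt, hT.zero]
  rw [continuousWithinAt_Ioi_iff_Ici, show Set.Ici (0 : ℝ≥0) = Set.univ from Set.Ici_bot,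
    continuousWithinAt_univ, ContinuousAt, hT.zero] at h
  exact h

/-- Contractivity bounds increments of an orbit by the increment from time zero over `|t - s|`,
which is written with truncated subtraction. -/
theorem norm_sub_le (s t : ℝ≥0) (u : Lp ℝ 2 π) :
    ‖T t u - T s u‖ ≤ ‖T ((t - s) + (s - t)) u - u‖ := by
  rcases le_total s t with h | h
  · have e : T t u = T s (T (t - s) u) := by rw [← hT.add, add_tsub_cancel_of_le h]
    rw [tsub_eq_zero_of_le h, add_zero, e, ← hT.map_sub]
    exact hT.norm_le _ _
  · have e : T s u = T t (T (s - t) u) := by rw [← hT.add, add_tsub_cancel_of_le h]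
    rw [tsub_eq_zero_of_le h, zero_add, e, ← hT.map_sub, norm_sub_rev (T _ u) u]
    exact (hT.norm_le _ _)

theorem continuous_apply (u : Lp ℝ 2 π) : Continuous fun t => T t u := by
  refine continuous_iff_continuousAt.2 fun s => ?_
  rw [ContinuousAt, tendsto_iff_norm_sub_tendsto_zero]
  refine squeeze_zero (fun _ => norm_nonneg _) (fun t => hT.norm_sub_le s t u) ?_
  have h0 : Tendsto (fun t : ℝ≥0 => (t - s) + (s - t)) (𝓝 s) (𝓝 0) := by
    have : Continuous fun t : ℝ≥0 => (t - s) + (s - t) := by fun_prop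
    simpa using this.tendsto s
  exact tendsto_iff_norm_sub_tendsto_zero.1 ((hT.tendsto_nhds_zero u).comp h0)

theorem continuous_toNNReal (u : Lp ℝ 2 π) : Continuous fun t : ℝ => T t.toNNReal u :=
  (hT.continuous_apply u).comp continuous_real_toNNReal

/-- Laplace transforms of orbits solve the resolvent equation; the case `α = 0` is the Poisson
equation. -/
theorem hasGenerator_laplace (α : ℝ) (x : Lp ℝ 2 π)
    (hint : IntegrableOn (fun t : ℝ => Real.exp (-α * t) • T t.toNNReal x) (Set.Ioi 0)) :
    HasGenerator T (∫ t in Set.Ioi (0 : ℝ), Real.exp (-α * t) • T t.toNNReal x)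
      (α • (∫ t in Set.Ioi (0 : ℝ), Real.exp (-α * t) • T t.toNNReal x) - x) := by
  set F : ℝ → Lp ℝ 2 π := fun t => Real.exp (-α * t) • T t.toNNReal x with hF
  set y := ∫ t in Set.Ioi (0 : ℝ), F t with hy
  have hFc : Continuous F :=
    (Real.continuous_exp.comp (continuous_const.mul continuous_id)).smul (hT.continuous_toNNReal x)
  have key : ∀ h : ℝ≥0, T h y = Real.exp (α * h) • (y - ∫ t in (0 : ℝ)..h, F t) := by
    intro h
    have e1 : T h y = ∫ t in Set.Ioi (0 : ℝ), T h (F t) :=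
      ((hT.clm h).integral_comp_comm hint).symm
    have e2 : ∫ t in Set.Ioi (0 : ℝ), T h (F t)
        = ∫ t in Set.Ioi (0 : ℝ), Real.exp (α * h) • F (t + h) := by
      refine setIntegral_congr_fun measurableSet_Ioi fun t ht => ?_
      have ht0 : (0 : ℝ) ≤ t := le_of_lt ht
      simp only [hF]
      rw [hT.map_smul, ← hT.add, smul_smul, ← Real.exp_add, Real.toNNReal_add ht0 h.coe_nonneg,
        Real.toNNReal_coe, add_comm h]
      congr 2
      ring
    have e3 : ∫ t in Set.Ioi (0 : ℝ), F (t + h) = ∫ t in Set.Ioi (h : ℝ), F t := by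
      rw [← (measurePreserving_add_right volume (h : ℝ)).setIntegral_preimage_emb
        (measurableEmbedding_addRight (h : ℝ)) F (Set.Ioi (h : ℝ))]
      congr 2
      ext t
      simp
    have e4 := intervalIntegral.integral_interval_add_Ioi hint
      (hint.mono_set (Set.Ioi_subset_Ioi h.coe_nonneg))
    rw [e1, e2, integral_smul, e3, hy, ← e4, add_sub_cancel_left]
  have hco : Tendsto (fun h : ℝ≥0 => (h : ℝ)) (𝓝[>] 0) (𝓝[≠] 0) := by
    refine tendsto_nhdsWithin_iff.2 ⟨?_, ?_⟩
    · exact (NNReal.continuous_coe.tendsto 0).mono_left nhdsWithin_le_nhds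
    · filter_upwards [self_mem_nhdsWithin] with h hh
      simpa using (ne_of_gt hh)
  have d1 : HasDerivAt (fun h : ℝ => Real.exp (α * h) • (y - ∫ t in (0 : ℝ)..h, F t))
      (α • y - x) 0 := by
    have a1 : HasDerivAt (fun h : ℝ => Real.exp (α * h)) α 0 := by
      have := ((hasDerivAt_id (0 : ℝ)).const_mul α).exp
      simpa using this
    have a2 : HasDerivAt (fun h : ℝ => ∫ t in (0 : ℝ)..h, F t) (F 0) 0 :=
      intervalIntegral.integral_hasDerivAt_right (hFc.intervalIntegrable _ _)
        hFc.stronglyMeasurable.stronglyMeasurableAtFilter hFc.continuousAt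
    have a3 := a1.smul (a2.const_sub y)
    have : F 0 = x := by simp [hF, hT.zero]
    rw [this] at a3
    refine a3.congr_deriv ?_
    simp only [mul_zero, Real.exp_zero, one_smul, intervalIntegral.integral_same, sub_zero]
    abel
  have d2 := (hasDerivAt_iff_tendsto_slope_zero.1 d1).comp hco
  refine d2.congr fun h => ?_
  simp [key]

theorem exists_resolvent {α : ℝ} (hα : 0 < α) (x : Lp ℝ 2 π) :
    ∃ y, HasGenerator T y (α • y - x) := by
  refine ⟨_, hT.hasGenerator_laplace α x ?_⟩
  refine Integrable.mono' ((exp_neg_integrableOn_Ioi 0 hα).mul_const ‖x‖) ?_ ?_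
  · exact ((Real.continuous_exp.comp (continuous_const.mul continuous_id)).smul
      (hT.continuous_toNNReal x)).aestronglyMeasurable
  · refine ae_of_all _ fun t => ?_
    rw [norm_smul, Real.norm_eq_abs, Real.abs_exp]
    gcongr
    exact hT.norm_le _ _

/-- The resolvent is a contraction up to the factor `α`. -/
theorem norm_resolvent_le {α : ℝ} {x y : Lp ℝ 2 π}
    (h : HasGenerator T y (α • y - x)) : α * ‖y‖ ≤ ‖x‖ := by
  have h1 := hT.inner_generator_nonpos h
  rw [inner_sub_left, real_inner_smul_left, real_inner_self_eq_norm_sq] at h1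
  have h2 := real_inner_le_norm x y
  rcases (norm_nonneg y).eq_or_lt with h0 | h0
  · rw [← h0, mul_zero]; exact norm_nonneg x
  · refine le_of_mul_le_mul_right ?_ h0
    nlinarith

end IsContractionSemigroup

/-! ### The potential of an exponentially ergodic semigroup -/

/-- A contraction semigroup with an invariant unit vector `e` (the constant function one) whose
mass `⟨e, u⟩` is conserved, and which decays exponentially on the orthogonal complement of `e`. -/
structure IsErgodicSemigroup (T : ℝ≥0 → Lp ℝ 2 π → Lp ℝ 2 π) (e : Lp ℝ 2 π) (C lam : ℝ) :
    Prop extends IsContractionSemigroup T where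
  inner_self : inner ℝ e e = (1 : ℝ)
  map_unit : ∀ t, T t e = e
  inner_unit : ∀ t u, inner ℝ e (T t u) = inner ℝ e u
  lam_pos : 0 < lam
  decay : ∀ u, inner ℝ e u = (0 : ℝ) → ∀ t : ℝ≥0, ‖T t u‖ ≤ C * ‖u‖ * Real.exp (-lam * t)

/-- The component of `u` orthogonal to the unit vector `e`. -/
noncomputable def centered (e u : Lp ℝ 2 π) : Lp ℝ 2 π := u - (inner ℝ e u : ℝ) • e

namespace IsErgodicSemigroup

variable {e : Lp ℝ 2 π} {C lam : ℝ} (hT : IsErgodicSemigroup T e C lam)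
include hT

theorem inner_centered (u : Lp ℝ 2 π) : inner ℝ e (centered e u) = (0 : ℝ) := by
  rw [centered, inner_sub_right, real_inner_smul_right, hT.inner_self, mul_one, sub_self]

theorem map_centered (t : ℝ≥0) (u : Lp ℝ 2 π) : T t (centered e u) = centered e (T t u) := by
  rw [centered, hT.map_sub, hT.map_smul, hT.map_unit, centered, hT.inner_unit]

theorem integrableOn_apply {u : Lp ℝ 2 π} (hu : inner ℝ e u = (0 : ℝ)) :
    IntegrableOn (fun t : ℝ => T t.toNNReal u) (Set.Ioi 0) := by
  refine Integrable.mono' ((exp_neg_integrableOn_Ioi 0 hT.lam_pos).const_mul (C * ‖u‖))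
    (hT.continuous_toNNReal u).aestronglyMeasurable ?_
  refine (ae_restrict_iff' measurableSet_Ioi).2 (ae_of_all _ fun t ht => ?_)
  have := hT.decay u hu t.toNNReal
  rwa [Real.coe_toNNReal t (le_of_lt ht)] at this

theorem norm_potential_le {u : Lp ℝ 2 π} (hu : inner ℝ e u = (0 : ℝ)) :
    ‖potential T u‖ ≤ (C * ∫ t in Set.Ioi (0 : ℝ), Real.exp (-lam * t)) * ‖u‖ := by
  have h : ‖potential T u‖ ≤ ∫ t in Set.Ioi (0 : ℝ), C * ‖u‖ * Real.exp (-lam * t) := by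
    refine norm_integral_le_of_norm_le
      ((exp_neg_integrableOn_Ioi 0 hT.lam_pos).const_mul (C * ‖u‖)) ?_
    refine (ae_restrict_iff' measurableSet_Ioi).2 (ae_of_all _ fun t ht => ?_)
    have := hT.decay u hu t.toNNReal
    rwa [Real.coe_toNNReal t (le_of_lt ht)] at this
  rw [integral_const_mul] at h
  linarith

/-- The Poisson equation: the potential of a centered element inverts minus the generator. -/
theorem hasGenerator_potential {u : Lp ℝ 2 π} (hu : inner ℝ e u = (0 : ℝ)) :
    HasGenerator T (potential T u) (-u) := by
  have h := hT.hasGenerator_laplace 0 u (by simpa using hT.integrableOn_apply hu)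
  simpa [potential] using h

theorem map_potential (h : ℝ≥0) {u : Lp ℝ 2 π} (hu : inner ℝ e u = (0 : ℝ)) :
    T h (potential T u) = potential T (T h u) := by
  have e1 : T h (potential T u) = ∫ t in Set.Ioi (0 : ℝ), T h (T t.toNNReal u) :=
    ((hT.clm h).integral_comp_comm (hT.integrableOn_apply hu)).symm
  rw [e1, potential]
  congr 1 with t : 1
  rw [← hT.add, ← hT.add, add_comm]

theorem norm_centered_le (u : Lp ℝ 2 π) : ‖centered e u‖ ≤ ‖u‖ := by
  have h : inner ℝ u u = inner ℝ (centered e u) (centered e u) + (inner ℝ e u : ℝ) ^ 2 := by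
    simp only [centered, inner_sub_left, inner_sub_right, real_inner_smul_left,
      real_inner_smul_right, hT.inner_self, real_inner_comm e u]
    ring
  rw [real_inner_self_eq_norm_sq, real_inner_self_eq_norm_sq] at h
  exact abs_le_of_sq_le_sq' (by nlinarith [sq_nonneg (inner ℝ e u : ℝ)]) (norm_nonneg _) |>.2

/-- The potential operator, precomposed with the projection onto the centered elements. -/
noncomputable def potentialCLM : Lp ℝ 2 π →L[ℝ] Lp ℝ 2 π :=
  LinearMap.mkContinuous
    { toFun := fun u => potential T (centered e u)
      map_add' := fun u v => by
        have : centered e (u + v) = centered e u + centered e v := by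
          simp only [centered, inner_add_right, add_smul]
          abel
        simp only [this, potential, hT.map_add]
        exact integral_add (hT.integrableOn_apply (hT.inner_centered u))
          (hT.integrableOn_apply (hT.inner_centered v))
      map_smul' := fun c u => by
        have : centered e (c • u) = c • centered e u := by
          simp only [centered, real_inner_smul_right, smul_sub, smul_smul]
        simp only [this, potential, hT.map_smul, RingHom.id_apply]
        exact integral_smul _ _ }
    |C * ∫ t in Set.Ioi (0 : ℝ), Real.exp (-lam * t)| fun u =>
      (hT.norm_potential_le (hT.inner_centered u)).trans
        (mul_le_mul (le_abs_self _) (hT.norm_centered_le u) (norm_nonneg _) (abs_nonneg _))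

theorem potentialCLM_apply (u : Lp ℝ 2 π) : hT.potentialCLM u = potential T (centered e u) := rfl

theorem potentialCLM_of_inner_eq_zero {u : Lp ℝ 2 π} (hu : inner ℝ e u = (0 : ℝ)) :
    hT.potentialCLM u = potential T u := by
  rw [potentialCLM_apply, centered, hu, zero_smul, sub_zero]

/-- On the domain of the generator `L`, the potential operator is also a left inverse of `-L`,
up to centering. -/
theorem potentialCLM_generator {v w : Lp ℝ 2 π} (h : HasGenerator T v w) :
    hT.potentialCLM w = -centered e v := by
  have h1 := hT.hasGenerator_potential (hT.inner_centered v)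
  refine tendsto_nhds_unique ((hT.potentialCLM.continuous.tendsto w).comp h) (h1.congr fun t => ?_)
  rw [Function.comp_apply, map_smul, _root_.map_sub, hT.map_potential t (hT.inner_centered v),
    hT.map_centered, potentialCLM_apply, potentialCLM_apply]

end IsErgodicSemigroup

end ContractionSemigroup

/-! ### The energy form on the domain of the generator -/

section Form

variable {S : Type*} [MeasurableSpace S] {π : Measure S} {T : ℝ≥0 → Lp ℝ 2 π → Lp ℝ 2 π}

theorem HasGenerator.preForm_eq {u w : Lp ℝ 2 π} (h : HasGenerator T u w) (v : Lp ℝ 2 π) :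
    preForm T u v = inner ℝ (-w) v := by
  rw [preForm, h.generator_eq]

theorem preForm_add_right (u v w : Lp ℝ 2 π) :
    preForm T u (v + w) = preForm T u v + preForm T u w := inner_add_right _ _ _

theorem preForm_sub_right (u v w : Lp ℝ 2 π) :
    preForm T u (v - w) = preForm T u v - preForm T u w := inner_sub_right _ _ _

theorem preForm_smul_right (u : Lp ℝ 2 π) (c : ℝ) (v : Lp ℝ 2 π) :
    preForm T u (c • v) = c * preForm T u v := real_inner_smul_right _ _ _

namespace IsContractionSemigroup

variable (hT : IsContractionSemigroup T)
include hT

theorem add_mem {u v : Lp ℝ 2 π} (hu : u ∈ generatorDomain T) (hv : v ∈ generatorDomain T) :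
    u + v ∈ generatorDomain T :=
  (hT.hasGenerator_add (hasGenerator_of_mem hu) (hasGenerator_of_mem hv)).mem

theorem smul_mem (c : ℝ) {u : Lp ℝ 2 π} (hu : u ∈ generatorDomain T) :
    c • u ∈ generatorDomain T :=
  (hT.hasGenerator_smul c (hasGenerator_of_mem hu)).mem

theorem sub_mem {u v : Lp ℝ 2 π} (hu : u ∈ generatorDomain T) (hv : v ∈ generatorDomain T) :
    u - v ∈ generatorDomain T := by
  rw [sub_eq_add_neg, ← neg_one_smul ℝ v]
  exact hT.add_mem hu (hT.smul_mem _ hv)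

theorem preForm_add_left {u v : Lp ℝ 2 π} (hu : u ∈ generatorDomain T)
    (hv : v ∈ generatorDomain T) (w : Lp ℝ 2 π) :
    preForm T (u + v) w = preForm T u w + preForm T v w := by
  rw [(hT.hasGenerator_add (hasGenerator_of_mem hu) (hasGenerator_of_mem hv)).preForm_eq,
    neg_add, inner_add_left]
  rfl

theorem preForm_smul_left (c : ℝ) {u : Lp ℝ 2 π} (hu : u ∈ generatorDomain T)
    (w : Lp ℝ 2 π) : preForm T (c • u) w = c * preForm T u w := by
  rw [(hT.hasGenerator_smul c (hasGenerator_of_mem hu)).preForm_eq, ← smul_neg,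
    real_inner_smul_left]
  rfl

theorem preForm_sub_left {u v : Lp ℝ 2 π} (hu : u ∈ generatorDomain T)
    (hv : v ∈ generatorDomain T) (w : Lp ℝ 2 π) :
    preForm T (u - v) w = preForm T u w - preForm T v w := by
  rw [sub_eq_add_neg, ← neg_one_smul ℝ v, hT.preForm_add_left hu (hT.smul_mem _ hv),
    hT.preForm_smul_left _ hv]
  ring

theorem preForm_self_nonneg {u : Lp ℝ 2 π} (hu : u ∈ generatorDomain T) :
    0 ≤ preForm T u u := by
  rw [preForm, inner_neg_left]
  linarith [hT.inner_generator_nonpos (hasGenerator_of_mem hu)]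

theorem preForm_parallelogram {u v : Lp ℝ 2 π} (hu : u ∈ generatorDomain T)
    (hv : v ∈ generatorDomain T) :
    preForm T (u + v) (u + v) + preForm T (u - v) (u - v)
      = 2 * preForm T u u + 2 * preForm T v v := by
  rw [hT.preForm_add_left hu hv, hT.preForm_sub_left hu hv]
  simp only [preForm_add_right, preForm_sub_right]
  ring

theorem preForm_add_self_le {u v : Lp ℝ 2 π} (hu : u ∈ generatorDomain T)
    (hv : v ∈ generatorDomain T) :
    preForm T (u + v) (u + v) ≤ 2 * preForm T u u + 2 * preForm T v v := by
  linarith [hT.preForm_parallelogram hu hv, hT.preForm_self_nonneg (hT.sub_mem hu hv)]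

/-! ### Approximating sequences and closability -/

omit hT in
theorem isApproximating_const {u : Lp ℝ 2 π} (hu : u ∈ generatorDomain T) :
    IsApproximating T (fun _ => u) u where
  mem _ := hu
  tendsto := tendsto_const_nhds
  cauchy := by simp [preForm]

theorem isApproximating_add {us vs : ℕ → Lp ℝ 2 π} {u v : Lp ℝ 2 π}
    (hu : IsApproximating T us u) (hv : IsApproximating T vs v) :
    IsApproximating T (fun n => us n + vs n) (u + v) where
  mem n := hT.add_mem (hu.mem n) (hv.mem n)
  tendsto := hu.tendsto.add hv.tendsto
  cauchy := by
    have h := (hu.cauchy.const_mul 2).add (hv.cauchy.const_mul 2)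
    simp only [mul_zero, add_zero] at h
    refine squeeze_zero (fun p => hT.preForm_self_nonneg ?_) (fun p => ?_) h
    · exact hT.sub_mem (hT.add_mem (hu.mem _) (hv.mem _)) (hT.add_mem (hu.mem _) (hv.mem _))
    · rw [add_sub_add_comm]
      exact hT.preForm_add_self_le (hT.sub_mem (hu.mem _) (hu.mem _))
        (hT.sub_mem (hv.mem _) (hv.mem _))

theorem isApproximating_smul (c : ℝ) {us : ℕ → Lp ℝ 2 π} {u : Lp ℝ 2 π}
    (hu : IsApproximating T us u) : IsApproximating T (fun n => c • us n) (c • u) where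
  mem n := hT.smul_mem c (hu.mem n)
  tendsto := hu.tendsto.const_smul c
  cauchy := by
    have h := hu.cauchy.const_mul (c * c)
    rw [mul_zero] at h
    refine h.congr fun p => ?_
    rw [← smul_sub, hT.preForm_smul_left c (hT.sub_mem (hu.mem _) (hu.mem _)),
      preForm_smul_right, mul_assoc]

theorem isApproximating_sub {us vs : ℕ → Lp ℝ 2 π} {u v : Lp ℝ 2 π}
    (hu : IsApproximating T us u) (hv : IsApproximating T vs v) :
    IsApproximating T (fun n => us n - vs n) (u - v) := by
  simpa [sub_eq_add_neg] using hT.isApproximating_add hu (hT.isApproximating_smul (-1) hv)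

theorem exists_energy_bound {us : ℕ → Lp ℝ 2 π} {u : Lp ℝ 2 π}
    (hu : IsApproximating T us u) : ∃ M, ∀ᶠ n in atTop, preForm T (us n) (us n) ≤ M := by
  obtain ⟨⟨a, N⟩, hN⟩ := eventually_atTop.1 (hu.cauchy.eventually (gt_mem_nhds one_pos))
  refine ⟨2 * 1 + 2 * preForm T (us N) (us N), ?_⟩
  filter_upwards [eventually_ge_atTop a] with n hn
  have h1 := hN (n, N) ⟨hn, le_rfl⟩
  have h2 := hT.preForm_add_self_le (hT.sub_mem (hu.mem n) (hu.mem N)) (hu.mem N)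
  rw [sub_add_cancel] at h2
  linarith

omit hT in
/-- Under the sector condition, vanishing energy of one argument and bounded energy of the other
make the form vanish, in either order of the arguments. -/
theorem tendsto_preForm_zero {K : ℝ} (hK0 : 0 < K)
    (hK : ∀ u ∈ generatorDomain T, ∀ v ∈ generatorDomain T,
      |preForm T u v| ≤ K * √(preForm T u u) * √(preForm T v v))
    {ι : Type*} {l : Filter ι} {x y : ι → Lp ℝ 2 π}
    (hx : ∀ i, x i ∈ generatorDomain T) (hy : ∀ i, y i ∈ generatorDomain T)
    (hx0 : Tendsto (fun i => preForm T (x i) (x i)) l (𝓝 0)) {M : ℝ}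
    (hM : ∀ᶠ i in l, preForm T (y i) (y i) ≤ M) :
    Tendsto (fun i => preForm T (x i) (y i)) l (𝓝 0) ∧
      Tendsto (fun i => preForm T (y i) (x i)) l (𝓝 0) := by
  have h0 : Tendsto (fun i => K * √(preForm T (x i) (x i)) * √M) l (𝓝 0) := by
    simpa using ((hx0.sqrt).const_mul K).mul_const (√M)
  constructor
  · refine squeeze_zero_norm' ?_ h0
    filter_upwards [hM] with i hi
    refine (hK _ (hx i) _ (hy i)).trans ?_
    gcongr
  · refine squeeze_zero_norm' ?_ h0
    filter_upwards [hM] with i hi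
    refine (hK _ (hy i) _ (hx i)).trans ?_
    rw [mul_right_comm]
    gcongr

/-- Closability: along a sequence that is Cauchy for the energy and tends to zero in `L²(π)`, the
energy tends to zero. -/
theorem tendsto_energy_zero (hS : SectorCondition T) {us : ℕ → Lp ℝ 2 π}
    (hu : IsApproximating T us 0) :
    Tendsto (fun n => preForm T (us n) (us n)) atTop (𝓝 0) := by
  obtain ⟨K, hK0, hK⟩ := hS
  obtain ⟨M, hM⟩ := hT.exists_energy_bound hu
  have h := (tendsto_preForm_zero hK0 hK (l := atTop) (x := fun p : ℕ × ℕ => us p.1 - us p.2)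
    (y := fun p => us p.1) (fun p => hT.sub_mem (hu.mem _) (hu.mem _)) (fun p => hu.mem _)
    hu.cauchy (M := M) (by
      rw [← prod_atTop_atTop_eq]
      exact tendsto_fst.eventually hM)).2
  refine Metric.tendsto_atTop.2 fun ε hε => ?_
  obtain ⟨⟨a, b⟩, hab⟩ := eventually_atTop.1 (h.eventually (gt_mem_nhds (half_pos hε)))
  refine ⟨a, fun n hn => ?_⟩
  rw [Real.dist_eq, sub_zero, abs_of_nonneg (hT.preForm_self_nonneg (hu.mem n))]
  -- let the second index tend to infinity, for fixed first index
  have hlim : Tendsto (fun m => preForm T (us n) (us n - us m)) atTop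
      (𝓝 (preForm T (us n) (us n))) := by
    have := (tendsto_const_nhds (x := -generator T (us n))).inner (𝕜 := ℝ)
      ((tendsto_const_nhds (x := us n)).sub hu.tendsto)
    rwa [sub_zero] at this
  have hle : preForm T (us n) (us n) ≤ ε / 2 := by
    refine le_of_tendsto hlim ?_
    filter_upwards [eventually_ge_atTop b] with m hm
    exact (hab (n, m) ⟨hn, hm⟩).le
  linarith

/-! ### The extended form -/

theorem tendsto_preForm_sub (hS : SectorCondition T) {us us' vs vs' : ℕ → Lp ℝ 2 π}
    {u v : Lp ℝ 2 π} (hu : IsApproximating T us u) (hu' : IsApproximating T us' u)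
    (hv : IsApproximating T vs v) (hv' : IsApproximating T vs' v) :
    Tendsto (fun n => preForm T (us n) (vs n) - preForm T (us' n) (vs' n)) atTop (𝓝 0) := by
  have hdu := hT.isApproximating_sub hu hu'
  have hdv := hT.isApproximating_sub hv hv'
  rw [sub_self] at hdu hdv
  have h1 := hT.tendsto_energy_zero hS hdu
  have h2 := hT.tendsto_energy_zero hS hdv
  obtain ⟨K, hK0, hK⟩ := hS
  obtain ⟨M, hM⟩ := hT.exists_energy_bound hv
  obtain ⟨M', hM'⟩ := hT.exists_energy_bound hu'
  have h := ((tendsto_preForm_zero hK0 hK hdu.mem hv.mem h1 hM).1).add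
    ((tendsto_preForm_zero hK0 hK hdv.mem hu'.mem h2 hM').2)
  rw [add_zero] at h
  refine h.congr fun n => ?_
  rw [hT.preForm_sub_left (hu.mem n) (hu'.mem n), preForm_sub_right]
  ring

theorem exists_tendsto_preForm (hS : SectorCondition T) {us vs : ℕ → Lp ℝ 2 π}
    {u v : Lp ℝ 2 π} (hu : IsApproximating T us u) (hv : IsApproximating T vs v) :
    ∃ c, Tendsto (fun n => preForm T (us n) (vs n)) atTop (𝓝 c) := by
  obtain ⟨K, hK0, hK⟩ := hS
  obtain ⟨M, hM⟩ := hT.exists_energy_bound hv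
  obtain ⟨M', hM'⟩ := hT.exists_energy_bound hu
  refine cauchySeq_tendsto_of_complete (cauchySeq_iff_tendsto_dist_atTop_0.2 ?_)
  have h1 := (tendsto_preForm_zero hK0 hK (l := atTop)
    (x := fun p : ℕ × ℕ => us p.1 - us p.2) (y := fun p => vs p.1)
    (fun p => hT.sub_mem (hu.mem _) (hu.mem _)) (fun p => hv.mem _) hu.cauchy (M := M) (by
      rw [← prod_atTop_atTop_eq]
      exact tendsto_fst.eventually hM)).1
  have h2 := (tendsto_preForm_zero hK0 hK (l := atTop)
    (x := fun p : ℕ × ℕ => vs p.1 - vs p.2) (y := fun p => us p.2)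
    (fun p => hT.sub_mem (hv.mem _) (hv.mem _)) (fun p => hu.mem _) hv.cauchy (M := M') (by
      rw [← prod_atTop_atTop_eq]
      exact tendsto_snd.eventually hM')).2
  have h := (h1.add h2).norm
  rw [add_zero, norm_zero] at h
  refine h.congr fun p => ?_
  rw [hT.preForm_sub_left (hu.mem _) (hu.mem _), preForm_sub_right, Real.dist_eq,
    Real.norm_eq_abs]
  congr 1
  ring

/-- Under the sector condition the extended form is the limit of the energy along any
approximating sequences. -/
theorem tendsto_form (hS : SectorCondition T) {us vs : ℕ → Lp ℝ 2 π} {u v : Lp ℝ 2 π}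
    (hu : IsApproximating T us u) (hv : IsApproximating T vs v) :
    Tendsto (fun n => preForm T (us n) (vs n)) atTop (𝓝 (form T u v)) := by
  have h : ∃ c : ℝ, ∀ us vs, IsApproximating T us u → IsApproximating T vs v →
      Tendsto (fun n => preForm T (us n) (vs n)) atTop (𝓝 c) := by
    obtain ⟨c, hc⟩ := hT.exists_tendsto_preForm hS hu hv
    refine ⟨c, fun us' vs' hu' hv' => ?_⟩
    have := hc.sub (hT.tendsto_preForm_sub hS hu hu' hv hv')
    simpa using this
  rw [form, dif_pos h]
  exact h.choose_spec us vs hu hv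

omit hT in
theorem mem_formDomain_of_mem {u : Lp ℝ 2 π} (hu : u ∈ generatorDomain T) :
    u ∈ formDomain T := ⟨_, isApproximating_const hu⟩

theorem formDomain_add {u v : Lp ℝ 2 π} (hu : u ∈ formDomain T) (hv : v ∈ formDomain T) :
    u + v ∈ formDomain T := by
  obtain ⟨us, hu⟩ := hu
  obtain ⟨vs, hv⟩ := hv
  exact ⟨_, hT.isApproximating_add hu hv⟩

theorem formDomain_smul (c : ℝ) {u : Lp ℝ 2 π} (hu : u ∈ formDomain T) :
    c • u ∈ formDomain T := by
  obtain ⟨us, hu⟩ := hu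
  exact ⟨_, hT.isApproximating_smul c hu⟩

theorem formDomain_sub {u v : Lp ℝ 2 π} (hu : u ∈ formDomain T) (hv : v ∈ formDomain T) :
    u - v ∈ formDomain T := by
  obtain ⟨us, hu⟩ := hu
  obtain ⟨vs, hv⟩ := hv
  exact ⟨_, hT.isApproximating_sub hu hv⟩

theorem form_add_left (hS : SectorCondition T) {u v w : Lp ℝ 2 π} (hu : u ∈ formDomain T)
    (hv : v ∈ formDomain T) (hw : w ∈ formDomain T) :
    form T (u + v) w = form T u w + form T v w := by
  obtain ⟨us, hu⟩ := hu
  obtain ⟨vs, hv⟩ := hv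
  obtain ⟨ws, hw⟩ := hw
  refine tendsto_nhds_unique (hT.tendsto_form hS (hT.isApproximating_add hu hv) hw)
    (((hT.tendsto_form hS hu hw).add (hT.tendsto_form hS hv hw)).congr fun n => ?_)
  rw [hT.preForm_add_left (hu.mem n) (hv.mem n)]

theorem form_add_right (hS : SectorCondition T) {u v w : Lp ℝ 2 π} (hu : u ∈ formDomain T)
    (hv : v ∈ formDomain T) (hw : w ∈ formDomain T) :
    form T u (v + w) = form T u v + form T u w := by
  obtain ⟨us, hu⟩ := hu
  obtain ⟨vs, hv⟩ := hv
  obtain ⟨ws, hw⟩ := hw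
  refine tendsto_nhds_unique (hT.tendsto_form hS hu (hT.isApproximating_add hv hw))
    (((hT.tendsto_form hS hu hv).add (hT.tendsto_form hS hu hw)).congr fun n => ?_)
  rw [preForm_add_right]

theorem form_smul_left (hS : SectorCondition T) (c : ℝ) {u w : Lp ℝ 2 π}
    (hu : u ∈ formDomain T) (hw : w ∈ formDomain T) :
    form T (c • u) w = c * form T u w := by
  obtain ⟨us, hu⟩ := hu
  obtain ⟨ws, hw⟩ := hw
  refine tendsto_nhds_unique (hT.tendsto_form hS (hT.isApproximating_smul c hu) hw)
    (((hT.tendsto_form hS hu hw).const_mul c).congr fun n => ?_)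
  rw [hT.preForm_smul_left c (hu.mem n)]

theorem form_smul_right (hS : SectorCondition T) (c : ℝ) {u w : Lp ℝ 2 π}
    (hu : u ∈ formDomain T) (hw : w ∈ formDomain T) :
    form T u (c • w) = c * form T u w := by
  obtain ⟨us, hu⟩ := hu
  obtain ⟨ws, hw⟩ := hw
  refine tendsto_nhds_unique (hT.tendsto_form hS hu (hT.isApproximating_smul c hw))
    (((hT.tendsto_form hS hu hw).const_mul c).congr fun n => ?_)
  rw [preForm_smul_right]

theorem form_self_nonneg (hS : SectorCondition T) {u : Lp ℝ 2 π} (hu : u ∈ formDomain T) :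
    0 ≤ form T u u := by
  obtain ⟨us, hu⟩ := hu
  exact ge_of_tendsto' (hT.tendsto_form hS hu hu) fun n => hT.preForm_self_nonneg (hu.mem n)

theorem form_of_hasGenerator (hS : SectorCondition T) {u w v : Lp ℝ 2 π}
    (hu : HasGenerator T u w) (hv : v ∈ formDomain T) : form T u v = inner ℝ (-w) v := by
  obtain ⟨vs, hv⟩ := hv
  refine tendsto_nhds_unique (hT.tendsto_form hS (isApproximating_const hu.mem) hv) ?_
  simp only [hu.preForm_eq]
  exact tendsto_const_nhds.inner hv.tendsto

/-- An `L²`-limit of elements of the generator domain with bounded energy lies in the form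
domain. Near-minimizers of the energy on shrinking balls form an energy-Cauchy sequence, by the
parallelogram identity. -/
theorem exists_isApproximating {b : Lp ℝ 2 π} {M : ℝ}
    (h : ∀ ε > 0, ∃ v ∈ generatorDomain T, ‖v - b‖ ≤ ε ∧ preForm T v v ≤ M) :
    ∃ us, IsApproximating T us b := by
  set r : ℕ → ℝ := fun n => 1 / ((n : ℝ) + 1) with hr
  have hr0 : ∀ n, 0 < r n := fun n => Nat.one_div_pos_of_nat
  have hrt : Tendsto r atTop (𝓝 0) := tendsto_one_div_add_atTop_nhds_zero_nat
  have hra : ∀ {m n : ℕ}, m ≤ n → r n ≤ r m := fun h => Nat.one_div_le_one_div h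
  set B : ℕ → Set (Lp ℝ 2 π) := fun n => {v | v ∈ generatorDomain T ∧ ‖v - b‖ ≤ r n} with hB
  set E : Lp ℝ 2 π → ℝ := fun v => preForm T v v with hE
  set I : ℕ → ℝ := fun n => sInf (E '' B n) with hI
  have hbdd : ∀ n, BddBelow (E '' B n) := by
    refine fun n => ⟨0, ?_⟩
    rintro _ ⟨v, hv, rfl⟩
    exact hT.preForm_self_nonneg hv.1
  have hne : ∀ n, ∃ v ∈ B n, E v ≤ M := fun n => by
    obtain ⟨v, hv, h1, h2⟩ := h (r n) (hr0 n)
    exact ⟨v, ⟨hv, h1⟩, h2⟩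
  have hIle : ∀ n, ∀ v ∈ B n, I n ≤ E v := fun n v hv => csInf_le (hbdd n) ⟨v, hv, rfl⟩
  have hBa : ∀ {m n : ℕ}, m ≤ n → B n ⊆ B m := fun hmn v hv => ⟨hv.1, hv.2.trans (hra hmn)⟩
  have hImono : Monotone I := fun m n hmn => by
    obtain ⟨v, hv, -⟩ := hne n
    exact csInf_le_csInf (hbdd m) ⟨_, v, hv, rfl⟩ (Set.image_mono (hBa hmn))
  have hIbdd : BddAbove (Set.range I) := by
    refine ⟨M, ?_⟩
    rintro _ ⟨n, rfl⟩
    obtain ⟨v, hv, h1⟩ := hne n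
    exact (hIle n v hv).trans h1
  have hIt := tendsto_atTop_ciSup hImono hIbdd
  have hIsup : ∀ n, I n ≤ ⨆ n, I n := fun n => le_ciSup hIbdd n
  have hc : ∀ n, ∃ c ∈ B n, E c < I n + r n := fun n => by
    obtain ⟨v, hv, -⟩ := hne n
    obtain ⟨_, ⟨c, hc, rfl⟩, h1⟩ := exists_lt_of_csInf_lt (s := E '' B n) ⟨_, v, hv, rfl⟩
      (show sInf (E '' B n) < I n + r n from lt_add_of_pos_right _ (hr0 n))
    exact ⟨c, hc, h1⟩
  choose c hcB hcE using hc
  have hg : Tendsto (fun p : ℕ × ℕ => 4 * ((⨆ n, I n) - I (min p.1 p.2)) + 4 * r (min p.1 p.2))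
      atTop (𝓝 0) := by
    have hmin : Tendsto (fun p : ℕ × ℕ => min p.1 p.2) atTop atTop :=
      tendsto_atTop.2 fun k => eventually_atTop.2 ⟨(k, k), fun p hp => le_min hp.1 hp.2⟩
    have := (((tendsto_const_nhds (x := ⨆ n, I n)).sub hIt).const_mul 4).add (hrt.const_mul 4)
    simp only [sub_self, mul_zero, add_zero] at this
    exact this.comp hmin
  refine ⟨c, fun n => (hcB n).1, ?_, ?_⟩
  · rw [tendsto_iff_norm_sub_tendsto_zero]
    exact squeeze_zero (fun _ => norm_nonneg _) (fun n => (hcB n).2) hrt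
  · refine squeeze_zero (fun p => hT.preForm_self_nonneg
      (hT.sub_mem (hcB _).1 (hcB _).1)) (fun p => ?_) hg
    obtain ⟨n, m⟩ := p
    set k := min n m with hk
    have hn := hBa (min_le_left n m) (hcB n)
    have hm := hBa (min_le_right n m) (hcB m)
    -- the midpoint stays in the larger of the two balls
    have hmid : (1 / 2 : ℝ) • (c n + c m) ∈ B k := by
      refine ⟨hT.smul_mem _ (hT.add_mem hn.1 hm.1), ?_⟩
      have e : (1 / 2 : ℝ) • (c n + c m) - b = (1 / 2 : ℝ) • ((c n - b) + (c m - b)) := by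
        module
      rw [e, norm_smul, Real.norm_of_nonneg (by norm_num)]
      have := norm_add_le (c n - b) (c m - b)
      linarith [hn.2, hm.2]
    have h1 := hIle k _ hmid
    simp only [hE] at h1
    rw [hT.preForm_smul_left _ (hT.add_mem hn.1 hm.1), preForm_smul_right] at h1
    have h2 := hT.preForm_parallelogram hn.1 hm.1
    have h3 := hcE n
    have h4 := hcE m
    have h5 := hra (min_le_left n m)
    have h6 := hra (min_le_right n m)
    have h7 := hIsup n
    have h8 := hIsup m
    simp only [hE] at h3 h4
    simp only
    linarith

end IsContractionSemigroup

end Form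

/-! ### The variational formulas -/

section Variational

variable {S : Type*} [MeasurableSpace S] {π : Measure S} {T : ℝ≥0 → Lp ℝ 2 π → Lp ℝ 2 π}

namespace IsErgodicSemigroup

variable {e : Lp ℝ 2 π} {C lam : ℝ} (hT : IsErgodicSemigroup T e C lam)
include hT

theorem potential_mem_formDomain {f : Lp ℝ 2 π} (hf : inner ℝ e f = (0 : ℝ)) :
    potential T f ∈ formDomain T :=
  IsContractionSemigroup.mem_formDomain_of_mem (hT.hasGenerator_potential hf).mem

theorem form_potential (hS : SectorCondition T) {f v : Lp ℝ 2 π} (hf : inner ℝ e f = (0 : ℝ))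
    (hv : v ∈ formDomain T) : form T (potential T f) v = inner ℝ f v := by
  rw [hT.form_of_hasGenerator hS (hT.hasGenerator_potential hf) hv, neg_neg]

/-- The adjoint `b` of the potential operator, applied to `f`, lies in the form domain and
represents `(·, f)` through the second argument of the form. Membership holds since the elements
`α (α - L)⁻¹ b` approximate `b` with bounded energy. -/
theorem exists_coPotential (hS : SectorCondition T) {f : Lp ℝ 2 π}
    (hf : inner ℝ e f = (0 : ℝ)) :
    ∃ b ∈ formDomain T, inner ℝ f b = inner ℝ (potential T f) f ∧
      ∀ v ∈ formDomain T, form T v b = inner ℝ v f := by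
  set b := ContinuousLinearMap.adjoint hT.potentialCLM f with hb
  have hadj : ∀ x, inner ℝ x b = inner ℝ (hT.potentialCLM x) f := fun x =>
    ContinuousLinearMap.adjoint_inner_right _ _ _
  have hgen : ∀ {v w}, HasGenerator T v w → inner ℝ (-w) b = inner ℝ v f := fun {v w} h => by
    rw [hadj, map_neg, hT.potentialCLM_generator h, neg_neg, centered, inner_sub_left,
      real_inner_smul_left, hf, mul_zero, sub_zero]
  have happ : ∃ us, IsApproximating T us b := by
    refine hT.exists_isApproximating (M := ‖b‖ * ‖f‖) fun ε hε => ?_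
    set M := ‖b‖ * ‖f‖ with hM
    have hM0 : 0 ≤ M := by positivity
    set α : ℝ := (M + 1) / ε ^ 2 with hα
    have hα0 : 0 < α := by positivity
    obtain ⟨y, hy⟩ := hT.exists_resolvent hα0 (α • b)
    have hyb : ‖y‖ ≤ ‖b‖ := by
      have := hT.norm_resolvent_le hy
      rw [norm_smul, Real.norm_of_nonneg hα0.le] at this
      exact le_of_mul_le_mul_left this hα0
    have h1 : preForm T y y = inner ℝ y f - α * ‖y - b‖ ^ 2 := by
      rw [← hgen hy, hy.preForm_eq, ← smul_sub, ← real_inner_self_eq_norm_sq,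
        ← smul_neg, real_inner_smul_left, real_inner_smul_left, ← mul_sub,
        inner_neg_left, inner_neg_left, inner_sub_right (y - b) y b]
      ring
    have h2 : inner ℝ y f ≤ M :=
      (real_inner_le_norm y f).trans (mul_le_mul_of_nonneg_right hyb (norm_nonneg f))
    have h3 := hT.preForm_self_nonneg hy.mem
    refine ⟨y, hy.mem, ?_, ?_⟩
    · have h4 : α * ‖y - b‖ ^ 2 ≤ α * ε ^ 2 := by
        have : α * ε ^ 2 = M + 1 := by rw [hα]; field_simp
        linarith
      exact abs_le_of_sq_le_sq' (le_of_mul_le_mul_left h4 hα0) hε.le |>.2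
    · have : 0 ≤ α * ‖y - b‖ ^ 2 := by positivity
      linarith
  refine ⟨b, happ, ?_, fun v hv => ?_⟩
  · rw [hadj, hT.potentialCLM_of_inner_eq_zero hf]
  obtain ⟨us, hu⟩ := happ
  obtain ⟨vs, hv⟩ := hv
  have hlim := hT.tendsto_form hS hv hu
  obtain ⟨K, hK0, hK⟩ := hS
  obtain ⟨M, hM⟩ := hT.exists_energy_bound hv
  have h := (IsContractionSemigroup.tendsto_preForm_zero hK0 hK (l := atTop)
    (x := fun p : ℕ × ℕ => us p.1 - us p.2) (y := fun p => vs p.1)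
    (fun p => hT.sub_mem (hu.mem _) (hu.mem _)) (fun p => hv.mem _) hu.cauchy (M := M) (by
      rw [← prod_atTop_atTop_eq]
      exact tendsto_fst.eventually hM)).2
  have hdiff : Tendsto (fun n => preForm T (vs n) (us n) - inner ℝ (vs n) f) atTop (𝓝 0) := by
    refine Metric.tendsto_atTop.2 fun ε hε => ?_
    obtain ⟨⟨a, a'⟩, ha⟩ := eventually_atTop.1
      (h.norm.eventually (gt_mem_nhds (show ‖(0 : ℝ)‖ < ε / 2 by simpa using half_pos hε)))
    refine ⟨a, fun n hn => ?_⟩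
    rw [dist_zero_right]
    -- let the second index tend to infinity, for fixed first index
    have hl : Tendsto (fun m => preForm T (vs n) (us n - us m)) atTop
        (𝓝 (preForm T (vs n) (us n) - inner ℝ (vs n) f)) := by
      have := (tendsto_const_nhds (x := -generator T (vs n))).inner (𝕜 := ℝ)
        ((tendsto_const_nhds (x := us n)).sub hu.tendsto)
      rwa [inner_sub_right, hgen (hasGenerator_of_mem (hv.mem n))] at this
    have hle : ‖preForm T (vs n) (us n) - inner ℝ (vs n) f‖ ≤ ε / 2 := by
      refine le_of_tendsto hl.norm ?_
      filter_upwards [eventually_ge_atTop a'] with m hm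
      exact (ha (n, m) ⟨hn, hm⟩).le
    linarith
  have hsum := hdiff.add (hv.tendsto.inner (𝕜 := ℝ) (tendsto_const_nhds (x := f)))
  rw [zero_add] at hsum
  exact tendsto_nhds_unique hlim (hsum.congr fun n => by ring)

/-- If `(G f, f) = E(G f, G f)` vanished, the sector condition would make `f = -L G f` orthogonal to
the domain of `L`; testing with the resolvent `(1 - L)⁻¹ f` gives `f = 0`. -/
theorem inner_potential_pos (hS : SectorCondition T) {f : Lp ℝ 2 π}
    (hf : inner ℝ e f = (0 : ℝ)) (hf0 : f ≠ 0) : 0 < inner ℝ (potential T f) f := by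
  have ha := hT.hasGenerator_potential hf
  have haa : preForm T (potential T f) (potential T f) = inner ℝ (potential T f) f := by
    rw [ha.preForm_eq, neg_neg, real_inner_comm]
  refine lt_of_le_of_ne (haa ▸ hT.preForm_self_nonneg ha.mem) fun h0 => hf0 ?_
  obtain ⟨y, hy⟩ := hT.exists_resolvent one_pos f
  obtain ⟨K, hK0, hK⟩ := hS
  have h1 := hK _ ha.mem _ hy.mem
  rw [haa, ← h0, Real.sqrt_zero, mul_zero, zero_mul, ha.preForm_eq, neg_neg] at h1
  have h2 : inner ℝ f y = (0 : ℝ) := abs_nonpos_iff.1 h1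
  have h3 := hT.inner_generator_nonpos hy
  rw [inner_sub_left, h2, one_smul, sub_zero] at h3
  have hy0 : y = 0 := real_inner_self_nonpos.1 h3
  subst hy0
  have h4 : HasGenerator T 0 0 := by
    simpa using hT.hasGenerator_smul 0 hy
  have h5 := tendsto_nhds_unique h4 hy
  simpa using h5

/-- The form at perturbations of `a / c` and `b / c` orthogonal to `f`: the cross terms vanish. -/
theorem form_saddle (hS : SectorCondition T) {f a b : Lp ℝ 2 π} {c : ℝ} (hc : c ≠ 0)
    (ha : a ∈ formDomain T) (hb : b ∈ formDomain T) (hfb : inner ℝ f b = c)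
    (hform_a : ∀ v ∈ formDomain T, form T a v = inner ℝ f v)
    (hform_b : ∀ v ∈ formDomain T, form T v b = inner ℝ v f) {z w : Lp ℝ 2 π}
    (hz : z ∈ constraintSet T f 0) (hw : w ∈ constraintSet T f 0) :
    form T (c⁻¹ • a + z) (c⁻¹ • b + w) = c⁻¹ + form T z w := by
  have hca := hT.formDomain_smul c⁻¹ ha
  have hcb := hT.formDomain_smul c⁻¹ hb
  have hbw := hT.formDomain_add hcb hw.1
  rw [hT.form_add_left hS hca hz.1 hbw, hT.form_add_right hS hca hcb hw.1,
    hT.form_add_right hS hz.1 hcb hw.1, hT.form_smul_left hS _ ha hcb,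
    hT.form_smul_left hS _ ha hw.1, hform_a _ hcb, hform_a _ hw.1,
    hT.form_smul_right hS _ hz.1 hb, hform_b _ hz.1, hz.2, real_inner_comm w f, hw.2,
    real_inner_smul_right, hfb, inv_mul_cancel₀ hc]
  ring

/-- The saddle point formula. With `b` the co-potential, the saddle point is
`u = (a + b) / 2c`, `v = (a - b) / 2c`, where `a` is the potential of `f` and `c = (a, f)`. -/
theorem iInf_iSup_form (hS : SectorCondition T) {f : Lp ℝ 2 π}
    (hf : inner ℝ e f = (0 : ℝ)) (hf0 : f ≠ 0) :
    ⨅ u ∈ constraintSet T f 1, ⨆ v ∈ constraintSet T f 0,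
        ((form T (u + v) (u - v) : ℝ) : EReal)
      = (((inner ℝ (potential T f) f : ℝ)⁻¹ : ℝ) : EReal) := by
  obtain ⟨b, hb, hfb, hform_b⟩ := hT.exists_coPotential hS hf
  have hc := (hT.inner_potential_pos hS hf hf0).ne'
  set a := potential T f with ha_def
  have ha : a ∈ formDomain T := hT.potential_mem_formDomain hf
  have hform_a : ∀ v ∈ formDomain T, form T a v = inner ℝ f v :=
    fun v hv => hT.form_potential hS hf hv
  set c : ℝ := inner ℝ a f with hc_def
  have hsaddle : ∀ {z w : Lp ℝ 2 π}, z ∈ constraintSet T f 0 → w ∈ constraintSet T f 0 →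
      form T (c⁻¹ • a + z) (c⁻¹ • b + w) = c⁻¹ + form T z w :=
    fun hz hw => hT.form_saddle hS hc ha hb hfb hform_a hform_b hz hw
  set x := c⁻¹ • a with hx
  set y := c⁻¹ • b with hy
  have hxF : x ∈ formDomain T := hT.formDomain_smul _ ha
  have hyF : y ∈ formDomain T := hT.formDomain_smul _ hb
  have hxf : inner ℝ x f = (1 : ℝ) := by
    rw [hx, real_inner_smul_left, ← hc_def, inv_mul_cancel₀ hc]
  have hyf : inner ℝ y f = (1 : ℝ) := by
    rw [hy, real_inner_smul_left, real_inner_comm, hfb, inv_mul_cancel₀ hc]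
  have hu0 : (1 / 2 : ℝ) • (x + y) ∈ constraintSet T f 1 := by
    refine ⟨hT.formDomain_smul _ (hT.formDomain_add hxF hyF), ?_⟩
    rw [real_inner_smul_left, inner_add_left, hxf, hyf]
    norm_num
  have hv0 : (1 / 2 : ℝ) • (x - y) ∈ constraintSet T f 0 := by
    refine ⟨hT.formDomain_smul _ (hT.formDomain_sub hxF hyF), ?_⟩
    rw [real_inner_smul_left, inner_sub_left, hxf, hyf]
    norm_num
  refine le_antisymm ?_ ?_
  · refine iInf₂_le_of_le _ hu0 (iSup₂_le fun v hv => EReal.coe_le_coe_iff.2 ?_)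
    have hz : v - (1 / 2 : ℝ) • (x - y) ∈ constraintSet T f 0 :=
      ⟨hT.formDomain_sub hv.1 hv0.1, by rw [inner_sub_left, hv.2, hv0.2, sub_zero]⟩
    have hnz : (-1 : ℝ) • (v - (1 / 2 : ℝ) • (x - y)) ∈ constraintSet T f 0 :=
      ⟨hT.formDomain_smul _ hz.1, by rw [real_inner_smul_left, hz.2, mul_zero]⟩
    have e1 : (1 / 2 : ℝ) • (x + y) + v = x + (v - (1 / 2 : ℝ) • (x - y)) := by module
    have e2 : (1 / 2 : ℝ) • (x + y) - v = y + (-1 : ℝ) • (v - (1 / 2 : ℝ) • (x - y)) := by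
      module
    rw [e1, e2, hsaddle hz hnz, hT.form_smul_right hS _ hz.1 hz.1]
    linarith [hT.form_self_nonneg hS hz.1]
  · refine le_iInf₂ fun u hu => le_iSup₂_of_le _ hv0 (EReal.coe_le_coe_iff.2 ?_)
    have hz : u - (1 / 2 : ℝ) • (x + y) ∈ constraintSet T f 0 :=
      ⟨hT.formDomain_sub hu.1 hu0.1, by rw [inner_sub_left, hu.2, hu0.2, sub_self]⟩
    have e1 : u + (1 / 2 : ℝ) • (x - y) = x + (u - (1 / 2 : ℝ) • (x + y)) := by module
    have e2 : u - (1 / 2 : ℝ) • (x - y) = y + (u - (1 / 2 : ℝ) • (x + y)) := by module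
    rw [e1, e2, hsaddle hz hz]
    linarith [hT.form_self_nonneg hS hz.1]

end IsErgodicSemigroup

namespace IsContractionSemigroup

variable (hT : IsContractionSemigroup T)
  (hsym : ∀ t u v, inner ℝ v (T t u) = (inner ℝ (T t v) u : ℝ))

include hsym in
theorem preForm_comm {u v : Lp ℝ 2 π} (hu : u ∈ generatorDomain T)
    (hv : v ∈ generatorDomain T) : preForm T u v = preForm T v u := by
  have h1 := (hasGenerator_of_mem hu).inner (𝕜 := ℝ) (tendsto_const_nhds (x := v))
  have h2 := (hasGenerator_of_mem hv).inner (𝕜 := ℝ) (tendsto_const_nhds (x := u))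
  have h : inner ℝ (generator T u) v = (inner ℝ (generator T v) u : ℝ) := by
    refine tendsto_nhds_unique h1 (h2.congr fun t => ?_)
    rw [real_inner_smul_left, real_inner_smul_left, inner_sub_left, inner_sub_left,
      ← hsym t u v, real_inner_comm v u, real_inner_comm (T t u) v]
  rw [preForm, preForm, inner_neg_left, inner_neg_left, h]

include hT hsym

/-- A symmetric form satisfies the sector condition by the Cauchy–Schwarz inequality. -/
theorem sectorCondition_of_symmetric : SectorCondition T := by
  refine ⟨1, one_pos, fun u hu v hv => ?_⟩
  have hd : ∀ r : ℝ, 0 ≤ preForm T v v * (r * r) + 2 * preForm T u v * r + preForm T u u := by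
    intro r
    have h := hT.preForm_self_nonneg (hT.add_mem hu (hT.smul_mem r hv))
    rw [hT.preForm_add_left hu (hT.smul_mem r hv), hT.preForm_smul_left r hv,
      preForm_add_right, preForm_add_right, preForm_smul_right, preForm_smul_right,
      preForm_comm hsym hv hu] at h
    linarith
  have h := discrim_le_zero hd
  rw [discrim] at h
  rw [one_mul, ← Real.sqrt_mul (hT.preForm_self_nonneg hu)]
  exact Real.abs_le_sqrt (by nlinarith)

theorem form_comm {u v : Lp ℝ 2 π} (hu : u ∈ formDomain T) (hv : v ∈ formDomain T) :
    form T u v = form T v u := by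
  have hS := hT.sectorCondition_of_symmetric hsym
  obtain ⟨us, hu⟩ := hu
  obtain ⟨vs, hv⟩ := hv
  exact tendsto_nhds_unique (hT.tendsto_form hS hu hv)
    ((hT.tendsto_form hS hv hu).congr fun n => preForm_comm hsym (hv.mem n) (hu.mem n))

end IsContractionSemigroup

theorem IsErgodicSemigroup.iInf_form_of_symmetric {e : Lp ℝ 2 π} {C lam : ℝ}
    (hT : IsErgodicSemigroup T e C lam)
    (hsym : ∀ t u v, inner ℝ v (T t u) = (inner ℝ (T t v) u : ℝ)) {f : Lp ℝ 2 π}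
    (hf : inner ℝ e f = (0 : ℝ)) (hf0 : f ≠ 0) :
    ⨅ u ∈ constraintSet T f 1, ((form T u u : ℝ) : EReal)
      = (((inner ℝ (potential T f) f : ℝ)⁻¹ : ℝ) : EReal) := by
  have hS := hT.sectorCondition_of_symmetric hsym
  have hc := (hT.inner_potential_pos hS hf hf0).ne'
  set a := potential T f with ha_def
  have ha : a ∈ formDomain T := hT.potential_mem_formDomain hf
  have hform_a : ∀ v ∈ formDomain T, form T a v = inner ℝ f v :=
    fun v hv => hT.form_potential hS hf hv
  set c : ℝ := inner ℝ a f with hc_def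
  have hform_b : ∀ v ∈ formDomain T, form T v a = inner ℝ v f := fun v hv => by
    rw [hT.form_comm hsym hv ha, hform_a v hv, real_inner_comm]
  have hsaddle : ∀ {z : Lp ℝ 2 π}, z ∈ constraintSet T f 0 →
      form T (c⁻¹ • a + z) (c⁻¹ • a + z) = c⁻¹ + form T z z :=
    fun hz => hT.form_saddle hS hc ha ha (real_inner_comm _ _) hform_a hform_b hz hz
  have hx : c⁻¹ • a ∈ constraintSet T f 1 :=
    ⟨hT.formDomain_smul _ ha, by rw [real_inner_smul_left, ← hc_def, inv_mul_cancel₀ hc]⟩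
  have hmin : ∀ u ∈ constraintSet T f 1,
      form T u u = c⁻¹ + form T (u - c⁻¹ • a) (u - c⁻¹ • a) := fun u hu => by
    have hz : u - c⁻¹ • a ∈ constraintSet T f 0 :=
      ⟨hT.formDomain_sub hu.1 hx.1, by rw [inner_sub_left, hu.2, hx.2, sub_self]⟩
    rw [← hsaddle hz, add_sub_cancel]
  refine le_antisymm ?_ ?_
  · refine iInf₂_le_of_le _ hx (EReal.coe_le_coe_iff.2 ?_)
    have h0 : form T (0 : Lp ℝ 2 π) 0 = 0 := by
      have := hT.form_smul_left hS 0 ha (hT.formDomain_smul 0 ha)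
      simpa using this
    rw [hmin _ hx, sub_self, h0, add_zero]
  · refine le_iInf₂ fun u hu => EReal.coe_le_coe_iff.2 ?_
    rw [hmin u hu]
    linarith [hT.form_self_nonneg hS (hT.formDomain_sub hu.1 hx.1)]

end Variational

/-! ### Laws of the stationary process -/

section Path

variable {S Ω : Type*} [MeasurableSpace S] [MeasurableSpace Ω] {π : Measure S}
  {Q : Measure Ω} [IsProbabilityMeasure Q] {P : ℝ≥0 → Kernel S S} [∀ t, IsMarkovKernel (P t)]
  {X : ℝ≥0 → Ω → S}

namespace IsMarkovProcess

omit [IsProbabilityMeasure Q] [∀ t, IsMarkovKernel (P t)] in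
theorem measurable_apply (hX : IsMarkovProcess P π Q X) (s : ℝ≥0) : Measurable (X s) :=
  hX.measurable.comp measurable_prodMk_left

/-- The Markov property, tested on events `X_s ∈ B` of the past, determines the joint law of two
coordinates. -/
theorem map_pair_eq_compProd_map (hX : IsMarkovProcess P π Q X) (s t : ℝ≥0) :
    Q.map (fun ω => (X s ω, X (s + t) ω)) = (Q.map (X s)) ⊗ₘ P t := by
  have hXs := hX.measurable_apply s
  have hXt := hX.measurable_apply (s + t)
  have hpair : Measurable (fun ω => (X s ω, X (s + t) ω)) := hXs.prodMk hXt
  have : IsProbabilityMeasure (Q.map (X s)) := Measure.isProbabilityMeasure_map hXs.aemeasurable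
  have : IsProbabilityMeasure (Q.map (fun ω => (X s ω, X (s + t) ω))) :=
    Measure.isProbabilityMeasure_map hpair.aemeasurable
  refine Measure.ext_prod fun {B A} hB hA => ?_
  have hmle : (⨆ r : Set.Iic s, MeasurableSpace.comap (X r) inferInstance)
      ≤ ‹MeasurableSpace Ω› :=
    iSup_le fun r => (hX.measurable_apply r).comap_le
  have hBm : MeasurableSet[⨆ r : Set.Iic s, MeasurableSpace.comap (X r) inferInstance]
      (X s ⁻¹' B) :=
    (le_iSup (fun r : Set.Iic s => MeasurableSpace.comap (X r) inferInstance)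
      ⟨s, Set.mem_Iic.2 le_rfl⟩) _ ⟨B, hB, rfl⟩
  have hint : Integrable ((X (s + t) ⁻¹' A).indicator fun _ => (1 : ℝ)) Q :=
    (integrable_const 1).indicator (hXt hA)
  have h1 := setIntegral_condExp hmle hint hBm
  rw [setIntegral_congr_ae (hmle _ hBm) ((hX.markov s t A hA).mono fun ω hω _ => hω),
    setIntegral_indicator (hXt hA), setIntegral_const, smul_eq_mul, mul_one] at h1
  have hk : Measurable fun x => P t x A := (P t).measurable_coe hA
  have h2 : ∫ ω in X s ⁻¹' B, (P t (X s ω)).real A ∂Q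
      = (∫⁻ ω in X s ⁻¹' B, P t (X s ω) A ∂Q).toReal :=
    integral_toReal (hk.comp hXs).aemeasurable (ae_of_all _ fun ω => measure_lt_top _ _)
  rw [h2, Measure.real] at h1
  rw [Measure.map_apply hpair (hB.prod hA), Measure.compProd_apply_prod hB hA,
    setLIntegral_map hB hk hXs]
  refine ((ENNReal.toReal_eq_toReal_iff' ?_ (measure_ne_top _ _)).1 h1).symm
  refine ne_top_of_le_ne_top ENNReal.one_ne_top ?_
  calc ∫⁻ ω in X s ⁻¹' B, P t (X s ω) A ∂Q ≤ ∫⁻ ω in X s ⁻¹' B, 1 ∂Q :=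
        lintegral_mono fun ω => prob_le_one
    _ ≤ 1 := by
        rw [lintegral_one, Measure.restrict_apply_univ]
        exact prob_le_one

variable [IsProbabilityMeasure π] (hπ : ∀ t, (P t).Invariant π)
  (hX : IsMarkovProcess P π Q X)
include hπ hX

theorem measurePreserving (t : ℝ≥0) : MeasurePreserving (X t) Q π := by
  refine ⟨hX.measurable_apply t, ?_⟩
  have h := hX.map_pair_eq_compProd_map 0 t
  rw [hX.initial, zero_add] at h
  have h2 := congrArg Measure.snd h
  rwa [snd_compProd_of_invariant (hπ t), Measure.snd_map_prodMk (hX.measurable_apply 0)] at h2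

theorem measurePreserving_pair (s t : ℝ≥0) :
    MeasurePreserving (fun ω => (X s ω, X (s + t) ω)) Q (π ⊗ₘ P t) := by
  refine ⟨(hX.measurable_apply s).prodMk (hX.measurable_apply (s + t)), ?_⟩
  rw [hX.map_pair_eq_compProd_map, (hX.measurePreserving hπ s).map_eq]

theorem integral_mul_apply (g : Lp ℝ 2 π) (s t : ℝ≥0) :
    ∫ ω, g (X s ω) * g (X (s + t) ω) ∂Q = inner ℝ g (semigroupL2 P hπ t g) := by
  rw [inner_semigroupL2]
  exact integral_comp_measurePreserving (hX.measurePreserving_pair hπ s t)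
    (integrable_fst_mul_snd (hπ t) g g).aestronglyMeasurable

/-- Functions that agree `π`-almost everywhere agree along almost every path, at almost every
time. -/
theorem ae_ae_path {p : S → Prop} (hp : ∀ᵐ x ∂π, p x) :
    ∀ᵐ ω ∂Q, ∀ᵐ s : ℝ, p (X s.toNNReal ω) := by
  obtain ⟨N, hN, hNm, hN0⟩ := exists_measurable_superset_of_null (ae_iff.1 hp)
  have hmeas : Measurable fun q : Ω × ℝ => X q.2.toNNReal q.1 :=
    hX.measurable.comp ((measurable_real_toNNReal.comp measurable_snd).prodMk measurable_fst)
  have h : ∀ᵐ ω ∂Q, ∀ᵐ s : ℝ, X s.toNNReal ω ∉ N := by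
    refine (Measure.ae_ae_comm (p := fun ω (s : ℝ) => X s.toNNReal ω ∉ N)
      (hmeas hNm.compl)).2 (ae_of_all _ fun s => ?_)
    have h0 : ∀ᵐ x ∂π, x ∉ N := measure_eq_zero_iff_ae_notMem.1 hN0
    exact (hX.measurePreserving hπ s.toNNReal).quasiMeasurePreserving.ae h0
  filter_upwards [h] with ω hω
  filter_upwards [hω] with s hs
  by_contra hcon
  exact hs (hN hcon)

omit hπ [∀ t, IsMarkovKernel (P t)] [IsProbabilityMeasure Q] [IsProbabilityMeasure π] in
theorem stronglyMeasurable_path (g : Lp ℝ 2 π) :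
    StronglyMeasurable fun q : ℝ × Ω => g (X q.1.toNNReal q.2) :=
  (Lp.stronglyMeasurable g).comp_measurable
    (hX.measurable.comp ((measurable_real_toNNReal.comp measurable_fst).prodMk measurable_snd))

theorem integrable_path (g : Lp ℝ 2 π) (ν : Measure ℝ) [IsFiniteMeasure ν] :
    Integrable (fun q : ℝ × Ω => g (X q.1.toNNReal q.2)) (ν.prod Q) := by
  have hg : Integrable g π := (Lp.memLp g).integrable one_le_two
  refine (integrable_prod_iff (hX.stronglyMeasurable_path g).aestronglyMeasurable).2
    ⟨ae_of_all _ fun s =>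
      (hX.measurePreserving hπ s.toNNReal).integrable_comp_of_integrable hg, ?_⟩
  have : ∀ s : ℝ, ∫ ω, ‖g (X s.toNNReal ω)‖ ∂Q = ∫ x, ‖g x‖ ∂π := fun s =>
    integral_comp_measurePreserving (hX.measurePreserving hπ s.toNNReal)
      hg.norm.aestronglyMeasurable
  simp only [this]
  exact integrable_const _

theorem ae_intervalIntegrable (g : Lp ℝ 2 π) (t : ℝ) :
    ∀ᵐ ω ∂Q, IntervalIntegrable (fun s : ℝ => g (X s.toNNReal ω)) volume 0 t := by
  have : IsFiniteMeasure (volume.restrict (Set.uIoc (0 : ℝ) t)) := by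
    rw [Set.uIoc]; infer_instance
  filter_upwards [(hX.integrable_path hπ g (volume.restrict (Set.uIoc (0 : ℝ) t))).prod_left_ae]
    with ω hω
  exact intervalIntegrable_iff.2 hω

/-! ### The second moment of the additive functional -/

/-- Integrability for Fubini: by stationarity the second moments of the coordinates are constant in
time. -/
theorem integrable_path_mul_path (g : Lp ℝ 2 π) (ν : Measure ℝ) [IsFiniteMeasure ν] :
    Integrable (fun q : (ℝ × ℝ) × Ω => g (X q.1.1.toNNReal q.2) * g (X q.1.2.toNNReal q.2))
      ((ν.prod ν).prod Q) := by
  have hm := hX.stronglyMeasurable_path g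
  have hmeas : StronglyMeasurable
      (fun q : (ℝ × ℝ) × Ω => g (X q.1.1.toNNReal q.2) * g (X q.1.2.toNNReal q.2)) :=
    (hm.comp_measurable (measurable_fst.fst.prodMk measurable_snd)).mul
      (hm.comp_measurable (measurable_fst.snd.prodMk measurable_snd))
  have hL : ∀ s : ℝ, MemLp (fun ω => g (X s.toNNReal ω)) 2 Q := fun s =>
    (Lp.memLp g).comp_measurePreserving (hX.measurePreserving hπ s.toNNReal)
  have hsq : ∀ s : ℝ, ∫ ω, g (X s.toNNReal ω) ^ 2 ∂Q = ‖g‖ ^ 2 := fun s => by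
    rw [norm_sq_eq_integral]
    exact integral_comp_measurePreserving (hX.measurePreserving hπ s.toNNReal)
      (Lp.memLp g).integrable_sq.aestronglyMeasurable
  have hi : ∀ s r : ℝ, Integrable (fun ω => g (X s.toNNReal ω) * g (X r.toNNReal ω)) Q :=
    fun s r => (hL s).integrable_mul (hL r)
  refine (integrable_prod_iff hmeas.aestronglyMeasurable).2 ⟨ae_of_all _ fun p => hi p.1 p.2, ?_⟩
  refine Integrable.mono' (integrable_const (‖g‖ ^ 2))
    hmeas.norm.integral_prod_right.aestronglyMeasurable (ae_of_all _ fun p => ?_)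
  rw [Real.norm_of_nonneg (integral_nonneg fun _ => norm_nonneg _)]
  have h1 := (hL p.1).integrable_sq
  have h2 := (hL p.2).integrable_sq
  calc ∫ ω, ‖g (X p.1.toNNReal ω) * g (X p.2.toNNReal ω)‖ ∂Q
      ≤ ∫ ω, (1 / 2) * (g (X p.1.toNNReal ω) ^ 2 + g (X p.2.toNNReal ω) ^ 2) ∂Q := by
        refine integral_mono (hi _ _).norm ((h1.add h2).const_mul _) fun ω => ?_
        simp only [norm_mul, Real.norm_eq_abs]
        have := two_mul_le_add_sq |g (X p.1.toNNReal ω)| |g (X p.2.toNNReal ω)|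
        simp only [sq_abs] at this
        linarith
    _ = ‖g‖ ^ 2 := by
        rw [integral_const_mul, integral_add h1 h2, hsq, hsq]
        ring

theorem integral_path_mul_path (g : Lp ℝ 2 π) {s r : ℝ} (hs : 0 ≤ s) (hr : 0 ≤ r) :
    ∫ ω, g (X s.toNNReal ω) * g (X r.toNNReal ω) ∂Q
      = inner ℝ g (semigroupL2 P hπ |s - r|.toNNReal g) := by
  wlog h : s ≤ r generalizing s r
  · rw [abs_sub_comm, ← this hr hs (le_of_not_ge h)]
    simp only [mul_comm]
  · have e : r.toNNReal = s.toNNReal + |s - r|.toNNReal := by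
      rw [← Real.toNNReal_add hs (abs_nonneg _), abs_sub_comm, abs_of_nonneg (sub_nonneg.2 h),
        add_sub_cancel]
    rw [e, hX.integral_mul_apply hπ]

/-- The second moment of the additive functional as a double integral of the autocovariance. -/
theorem integral_sq_integral_path (g : Lp ℝ 2 π) {t : ℝ} (ht : 0 ≤ t)
    (hc : Continuous fun s : ℝ => (inner ℝ g (semigroupL2 P hπ |s|.toNNReal g) : ℝ)) :
    Integrable (fun ω => (∫ s in (0 : ℝ)..t, g (X s.toNNReal ω)) ^ 2) Q ∧
      ∫ ω, (∫ s in (0 : ℝ)..t, g (X s.toNNReal ω)) ^ 2 ∂Q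
        = ∫ s in (0 : ℝ)..t, ∫ r in (0 : ℝ)..t,
            inner ℝ g (semigroupL2 P hπ |s - r|.toNNReal g) := by
  set ν : Measure ℝ := volume.restrict (Set.Ioc 0 t) with hν
  have hW := hX.integrable_path_mul_path hπ g ν
  have hZ : ∀ ω, (∫ s in (0 : ℝ)..t, g (X s.toNNReal ω)) ^ 2
      = ∫ p : ℝ × ℝ, g (X p.1.toNNReal ω) * g (X p.2.toNNReal ω) ∂(ν.prod ν) := fun ω => by
    rw [intervalIntegral.integral_of_le ht, sq]
    exact (integral_prod_mul (μ := ν) (ν := ν) (fun s : ℝ => g (X s.toNNReal ω))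
      (fun s : ℝ => g (X s.toNNReal ω))).symm
  simp only [hZ]
  refine ⟨hW.integral_prod_right, ?_⟩
  rw [← integral_integral_swap hW]
  have hpos : ∀ᵐ p ∂(ν.prod ν), 0 ≤ p.1 ∧ 0 ≤ p.2 := by
    rw [hν, Measure.prod_restrict]
    refine (ae_restrict_iff' (measurableSet_Ioc.prod measurableSet_Ioc)).2
      (ae_of_all _ fun p hp => ⟨hp.1.1.le, hp.2.1.le⟩)
  rw [integral_congr_ae (hpos.mono fun p hp => hX.integral_path_mul_path hπ g hp.1 hp.2)]
  have hcont : Continuous fun p : ℝ × ℝ =>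
      (inner ℝ g (semigroupL2 P hπ |p.1 - p.2|.toNNReal g) : ℝ) :=
    hc.comp (continuous_fst.sub continuous_snd)
  have hint : Integrable (fun p : ℝ × ℝ =>
      (inner ℝ g (semigroupL2 P hπ |p.1 - p.2|.toNNReal g) : ℝ)) (ν.prod ν) := by
    rw [hν, Measure.prod_restrict]
    refine (hcont.continuousOn.integrableOn_compact
      (isCompact_Icc.prod isCompact_Icc)).mono_set
      (Set.prod_mono Set.Ioc_subset_Icc_self Set.Ioc_subset_Icc_self)
  rw [integral_prod _ hint, intervalIntegral.integral_of_le ht]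
  refine integral_congr_ae (ae_of_all _ fun s => ?_)
  simp only
  rw [intervalIntegral.integral_of_le ht]

end IsMarkovProcess

/-! ### The long-time limit -/

/-- For an even continuous kernel the normalized double integral over a square is a mean of the
primitive. -/
theorem integral_integral_comp_sub {ρ : ℝ → ℝ} (hρ : Continuous ρ) (heven : ∀ s, ρ (-s) = ρ s)
    (t : ℝ) :
    ∫ s in (0 : ℝ)..t, ∫ r in (0 : ℝ)..t, ρ (s - r)
      = t * (2 * ∫ x in (0 : ℝ)..1, ∫ r in (0 : ℝ)..(t * x), ρ r) := by
  set R : ℝ → ℝ := fun s => ∫ r in (0 : ℝ)..s, ρ r with hR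
  have hRc : Continuous R :=
    intervalIntegral.continuous_primitive (fun a b => hρ.intervalIntegrable a b) 0
  have h1 : ∀ s, ∫ r in (0 : ℝ)..t, ρ (s - r) = R s + R (t - s) := fun s => by
    have hi : ∀ a b, IntervalIntegrable (fun r => ρ (s - r)) volume a b := fun a b =>
      (hρ.comp (continuous_const.sub continuous_id)).intervalIntegrable a b
    rw [← intervalIntegral.integral_add_adjacent_intervals (hi 0 s) (hi s t),
      intervalIntegral.integral_comp_sub_left, sub_self, sub_zero]
    congr 1
    have : ∀ r, ρ (s - r) = ρ (r - s) := fun r => by rw [← heven, neg_sub]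
    simp only [this]
    rw [intervalIntegral.integral_comp_sub_right, sub_self]
  simp only [h1]
  have hRi : IntervalIntegrable (fun s => R (t - s)) volume 0 t :=
    (hRc.comp (continuous_const.sub continuous_id)).intervalIntegrable _ _
  rw [intervalIntegral.integral_add (hRc.intervalIntegrable _ _) hRi,
    intervalIntegral.integral_comp_sub_left R, sub_self, sub_zero]
  have h2 := intervalIntegral.smul_integral_comp_mul_left (a := 0) (b := 1) R t
  rw [mul_zero, mul_one, smul_eq_mul] at h2
  rw [← h2]
  ring

/-- Continuous Cesàro means of the primitive of an integrable function converge to the full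
integral. -/
theorem tendsto_mean_primitive {ρ : ℝ → ℝ} (hρ : Continuous ρ)
    (hi : IntegrableOn ρ (Set.Ioi 0)) :
    Tendsto (fun t : ℝ => ∫ x in (0 : ℝ)..1, ∫ r in (0 : ℝ)..(t * x), ρ r) atTop
      (𝓝 (∫ r in Set.Ioi (0 : ℝ), ρ r)) := by
  set R : ℝ → ℝ := fun s => ∫ r in (0 : ℝ)..s, ρ r with hR
  have hRc : Continuous R :=
    intervalIntegral.continuous_primitive (fun a b => hρ.intervalIntegrable a b) 0
  have hlim : Tendsto R atTop (𝓝 (∫ r in Set.Ioi (0 : ℝ), ρ r)) :=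
    intervalIntegral_tendsto_integral_Ioi 0 hi tendsto_id
  have hbound : ∀ s, 0 ≤ s → ‖R s‖ ≤ ∫ r in Set.Ioi (0 : ℝ), ‖ρ r‖ := fun s hs => by
    refine (intervalIntegral.norm_integral_le_integral_norm hs).trans ?_
    rw [intervalIntegral.integral_of_le hs]
    exact setIntegral_mono_set hi.norm (ae_of_all _ fun _ => norm_nonneg _)
      (Set.Ioc_subset_Ioi_self.eventuallyLE)
  have h := intervalIntegral.tendsto_integral_filter_of_dominated_convergence (μ := volume)
    (a := 0) (b := 1) (l := atTop) (F := fun t x => R (t * x))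
    (f := fun _ => ∫ r in Set.Ioi (0 : ℝ), ρ r) (fun _ => ∫ r in Set.Ioi (0 : ℝ), ‖ρ r‖)
    (Eventually.of_forall fun t =>
      (hRc.comp (continuous_const.mul continuous_id)).aestronglyMeasurable)
    (by
      filter_upwards [eventually_ge_atTop 0] with t ht
      refine ae_of_all _ fun x hx => hbound _ (mul_nonneg ht ?_)
      rw [Set.uIoc_of_le zero_le_one] at hx
      exact hx.1.le)
    intervalIntegrable_const
    (ae_of_all _ fun x hx => by
      rw [Set.uIoc_of_le zero_le_one] at hx
      exact hlim.comp (tendsto_id.atTop_mul_const hx.1))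
  simpa using h

end Path

/-! ### The asymptotic variance -/

section Variance

variable {S Ω : Type*} [MeasurableSpace S] [MeasurableSpace Ω] {π : Measure S}
  [IsProbabilityMeasure π] {Q : Measure Ω} [IsProbabilityMeasure Q] {P : ℝ≥0 → Kernel S S}
  [∀ t, IsMarkovKernel (P t)] {X : ℝ≥0 → Ω → S}

theorem isContractionSemigroup_semigroupL2 (hP : IsTransitionSemigroup P)
    (hπ : ∀ t, (P t).Invariant π) (hcont : StronglyContinuous (semigroupL2 P hπ)) :
    IsContractionSemigroup (semigroupL2 P hπ) where
  map_add := semigroupL2_add P hπ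
  map_smul := semigroupL2_smul P hπ
  norm_le := norm_semigroupL2_le P hπ
  zero := semigroupL2_zero P hπ hP
  add := semigroupL2_add_time P hπ hP
  stronglyContinuous := hcont

theorem exists_isErgodicSemigroup (hP : IsTransitionSemigroup P)
    (hπ : ∀ t, (P t).Invariant π) (hcont : StronglyContinuous (semigroupL2 P hπ))
    (herg : ExponentiallyErgodic (semigroupL2 P hπ)) :
    ∃ C lam, IsErgodicSemigroup (semigroupL2 P hπ) (oneL2 π) C lam := by
  obtain ⟨C, lam, -, hlam, h⟩ := herg
  exact ⟨C, lam, {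
    toIsContractionSemigroup := isContractionSemigroup_semigroupL2 hP hπ hcont
    inner_self := inner_oneL2_self
    map_unit := semigroupL2_oneL2 P hπ
    inner_unit := inner_oneL2_semigroupL2 P hπ
    lam_pos := hlam
    decay := fun u hu => h u (by rwa [← inner_oneL2]) }⟩

/-- The normalized second moments converge to `2 (G g, g)`, for `g` a version of `f`. -/
theorem tendsto_scaledSecondMoment {hπ : ∀ t, (P t).Invariant π} {C lam : ℝ}
    (hT : IsErgodicSemigroup (semigroupL2 P hπ) (oneL2 π) C lam)
    (hX : IsMarkovProcess P π Q X) {f : S → ℝ} {g : Lp ℝ 2 π} (hfg : g =ᵐ[π] f)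
    (hg : inner ℝ (oneL2 π) g = (0 : ℝ)) :
    Tendsto (scaledSecondMoment Q X f) atTop
      (𝓝 (ENNReal.ofReal (2 * inner ℝ (potential (semigroupL2 P hπ) g) g))) := by
  set ρ : ℝ → ℝ := fun s => inner ℝ g (semigroupL2 P hπ |s|.toNNReal g) with hρ
  have hρc : Continuous ρ :=
    continuous_const.inner ((hT.continuous_toNNReal g).comp continuous_abs)
  have hρ0 : Set.EqOn ρ (fun s => inner ℝ g (semigroupL2 P hπ s.toNNReal g)) (Set.Ioi 0) :=
    fun s hs => by simp only [hρ, abs_of_pos (Set.mem_Ioi.1 hs)]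
  have hint := hT.integrableOn_apply hg
  have hρi : IntegrableOn ρ (Set.Ioi 0) :=
    (integrableOn_congr_fun hρ0 measurableSet_Ioi).2 (Integrable.const_inner g hint)
  have hρI : ∫ s in Set.Ioi (0 : ℝ), ρ s = inner ℝ (potential (semigroupL2 P hπ) g) g := by
    rw [setIntegral_congr_fun measurableSet_Ioi hρ0, integral_inner hint g, real_inner_comm,
      potential]
  have hlim := (tendsto_mean_primitive hρc hρi).const_mul 2
  rw [hρI] at hlim
  refine (ENNReal.tendsto_ofReal hlim).congr' ?_
  filter_upwards [eventually_gt_atTop 0] with t ht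
  obtain ⟨hi, hmoment⟩ := hX.integral_sq_integral_path hπ g ht.le hρc
  have hρsq := integral_integral_comp_sub hρc (fun s => by simp only [hρ, abs_neg]) t
  have hsq : ∀ z : ℝ, (1 / √t * z) ^ 2 = t⁻¹ * z ^ 2 := fun z => by
    rw [mul_pow, div_pow, one_pow, Real.sq_sqrt ht.le, one_div]
  have hfg' : (fun ω => ENNReal.ofReal ((1 / √t * ∫ s in (0 : ℝ)..t, f (X s.toNNReal ω)) ^ 2))
      =ᵐ[Q] fun ω => ENNReal.ofReal (t⁻¹ * (∫ s in (0 : ℝ)..t, g (X s.toNNReal ω)) ^ 2) := by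
    filter_upwards [hX.ae_ae_path hπ hfg] with ω hω
    rw [hsq, intervalIntegral.integral_congr_ae (hω.mono fun s hs _ => hs)]
  rw [scaledSecondMoment, lintegral_congr_ae hfg',
    ← ofReal_integral_eq_lintegral_ofReal (hi.const_mul _) (ae_of_all _ fun ω => by positivity),
    integral_const_mul, hmoment]
  congr 1
  simp only [hρ] at hρsq
  rw [hρsq, inv_mul_cancel_left₀ ht.ne']

omit [IsProbabilityMeasure π] in
theorem constraintSet_zero_one (T : ℝ≥0 → Lp ℝ 2 π → Lp ℝ 2 π) : constraintSet T 0 1 = ∅ := by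
  ext u
  simp [constraintSet]

theorem coe_two_div_ofReal {c : ℝ} (hc : 0 < c) :
    ((2 / ENNReal.ofReal (2 * c) : ℝ≥0∞) : EReal) = ((c⁻¹ : ℝ) : EReal) := by
  have h : (2 / ENNReal.ofReal (2 * c) : ℝ≥0∞) = ENNReal.ofReal c⁻¹ := by
    rw [← ENNReal.ofReal_ofNat 2, ← ENNReal.ofReal_div_of_pos (by positivity)]
    congr 1
    field_simp
  rw [h, EReal.coe_ennreal_ofReal, max_eq_left (by positivity)]

end Variance

end AsymptoticVariance

open AsymptoticVariance in
theorem theorem1p1 {S Ω : Type*} [TopologicalSpace S] [PolishSpace S] [MeasurableSpace S]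
    [BorelSpace S] [MeasurableSpace Ω]
    (π : Measure S) [IsProbabilityMeasure π] (Q : Measure Ω) [IsProbabilityMeasure Q]
    (P : ℝ≥0 → Kernel S S) [∀ t, IsMarkovKernel (P t)] (hP : IsTransitionSemigroup P)
    (hπ : ∀ t, (P t).Invariant π)
    (hcont : StronglyContinuous (semigroupL2 P hπ))
    (X : ℝ≥0 → Ω → S) (hX : IsMarkovProcess P π Q X)
    (herg : ExponentiallyErgodic (semigroupL2 P hπ))
    (f : S → ℝ) (hf : MemLp f 2 π) (hf0 : ∫ x, f x ∂π = 0) :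
    -- the limit exists, is finite, and is `2 (G f, f)`
    ((∀ t : ℝ, ∀ᵐ ω ∂Q, IntervalIntegrable (fun s : ℝ => f (X s.toNNReal ω)) volume 0 t) ∧
      Tendsto (scaledSecondMoment Q X f) atTop (𝓝 (asymptoticVariance Q X f)) ∧
      asymptoticVariance Q X f ≠ ∞ ∧
      IntegrableOn (fun t : ℝ => semigroupL2 P hπ t.toNNReal (hf.toLp f)) (Set.Ioi 0) ∧
      (asymptoticVariance Q X f).toReal =
        2 * inner ℝ (potential (semigroupL2 P hπ) (hf.toLp f)) (hf.toLp f)) ∧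
    -- the variational formula under the sector condition
    (SectorCondition (semigroupL2 P hπ) →
      ((2 / asymptoticVariance Q X f : ℝ≥0∞) : EReal) =
        ⨅ u ∈ constraintSet (semigroupL2 P hπ) (hf.toLp f) 1,
          ⨆ v ∈ constraintSet (semigroupL2 P hπ) (hf.toLp f) 0,
            ((form (semigroupL2 P hπ) (u + v) (u - v) : ℝ) : EReal)) ∧
    -- the reversible case
    ((∀ t, (P t).IsReversible π) →
      ((2 / asymptoticVariance Q X f : ℝ≥0∞) : EReal) =
        ⨅ u ∈ constraintSet (semigroupL2 P hπ) (hf.toLp f) 1,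
          ((form (semigroupL2 P hπ) u u : ℝ) : EReal)) := by

  obtain ⟨C, lam, hT⟩ := exists_isErgodicSemigroup hP hπ hcont herg
  set T := semigroupL2 P hπ with hTdef
  set g : Lp ℝ 2 π := hf.toLp f with hgdef
  have hfg : g =ᵐ[π] f := hf.coeFn_toLp
  have hg : inner ℝ (oneL2 π) g = (0 : ℝ) := by
    rw [inner_oneL2, integral_congr_ae hfg, hf0]
  have hlim := tendsto_scaledSecondMoment hT hX hfg hg
  have hσ : asymptoticVariance Q X f = ENNReal.ofReal (2 * inner ℝ (potential T g) g) :=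
    hlim.limsup_eq
  have hc0 : (0 : ℝ) ≤ inner ℝ (potential T g) g := by
    have h := hT.inner_generator_nonpos (hT.hasGenerator_potential hg)
    rw [inner_neg_left, real_inner_comm] at h
    linarith
  -- for `f = 0` both sides of the variational formulas are infinite
  have htop : g = 0 → ((2 / asymptoticVariance Q X f : ℝ≥0∞) : EReal) = ⊤ := fun h0 => by
    rw [hσ, h0, inner_zero_right, mul_zero, ENNReal.ofReal_zero,
      ENNReal.div_zero two_ne_zero, EReal.coe_ennreal_top]
  refine ⟨⟨fun t => ?_, hσ ▸ hlim, ?_, hT.integrableOn_apply hg, ?_⟩, fun hS => ?_,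
    fun hrev => ?_⟩
  · filter_upwards [hX.ae_intervalIntegrable hπ g t, hX.ae_ae_path hπ hfg] with ω h1 h2
    exact h1.congr_ae (ae_restrict_of_ae h2)
  · rw [hσ]
    exact ENNReal.ofReal_ne_top
  · rw [hσ, ENNReal.toReal_ofReal (by positivity)]
  · rcases eq_or_ne g 0 with h0 | h0
    · rw [htop h0, h0, constraintSet_zero_one]
      simp
    · rw [hT.iInf_iSup_form hS hg h0, hσ, coe_two_div_ofReal (hT.inner_potential_pos hS hg h0)]
  · have hsym := inner_semigroupL2_comm P hπ hrev
    rcases eq_or_ne g 0 with h0 | h0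
    · rw [htop h0, h0, constraintSet_zero_one]
      simp
    · have hS := hT.sectorCondition_of_symmetric hsym
      rw [hT.iInf_form_of_symmetric hsym hg h0, hσ,
        coe_two_div_ofReal (hT.inner_potential_pos hS hg h0)]
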